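/- There is an absolute constant $C$ such that the following holds for every probability space $(\Omega,\mathcal F,\mu)$, every $n\in\mathbb N$, every $1\le p<\infty$ and all (real or complex) $f_{i,j}\in L^1(\Omega^2)$, $i,j=1,\dots,n$. Put \[ N(f)=\int_{\Omega^n}\int_{\Omega^n}\Big(\sum_{i,j}|f_{i,j}(x_i,y_j)|^p\Big)^{1/p}\,dx\,dy, \] and for families $a=(a_{i,j})$, $b=(b_{i,j})$, $c=(c_{i,j})$, $d=(d_{i,j})$ of measurable functions on $\Omega^2$ put \[ \|a\|_{1}=\sum_{i,j}\int_\Omega\int_\Omega|a_{i,j}(\xi,\upsilon)|\,d\xi\,d\upsilon,\qquad \|b\|_{p}=\Big(\sum_{i,j}\int_\Omega\int_\Omega|b_{i,j}(\xi,\upsilon)|^p\,d\xi\,d\upsilon\Big)^{1/p}, \] \[ \|c\|_{1,p}=\sum_i\int_\Omega\Big(\sum_j\int_\Omega|c_{i,j}(\xi,\upsilon)|^p\,d\upsilon\Big)^{1/p}d\xi,\qquad \|d\|_{1,p}'=\sum_j\int_\Omega\Big(\sum_i\int_\Omega|d_{i,j}(\xi,\upsilon)|^p\,d\xi\Big)^{1/p}d\upsilon.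 \] These are the norms in $L^1(X\times Y)$, $L^p(X\times Y)$, $L^1(X,L^p(Y))$ and $L^1(Y,L^p(X))$, where $X=\coprod_{i=1}^n\Omega$ and $Y=\coprod_{j=1}^n\Omega$. Then \[ C^{-1}N(f)\;\le\;\inf_{f=a+b+c+d}\big(\|a\|_{1}+\|b\|_{p}+\|c\|_{1,p}+\|d\|_{1,p}'\big)\;\le\; C\,N(f), \] where the infimum is over all decompositions $f_{i,j}=a_{i,j}+b_{i,j}+c_{i,j}+d_{i,j}$ (almost everywhere, for all $i,j$) into measurable functions. Moreover, if $N(f)\le 1$, then there is such a decomposition with $\|a\|_{1}\le C$, $\|b\|_{p}\le C$, $\|c\|_{1,p}\le C$ and $\|d\|_{1,p}'\le C$ in which, for all $i,j$, the supports of $a_{i,j},b_{i,j},c_{i,j},d_{i,j}$ are pairwise disjoint. -/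

import Mathlib

open MeasureTheory
open scoped ENNReal NNReal

noncomputable section

/-! A family `f i j`, `i, j : Fin n`, of functions on `Ω × Ω` is the same as one function on
`(∐ i, Ω) × (∐ j, Ω)`, and integration over `∐ i, Ω` is the sum over `i` of the integrals over `Ω`.
All norms take values in `[0, ∞]`, the value `∞` meaning that the family is not in the space. -/

/-- `∫_{Ωⁿ} ∫_{Ωⁿ} (∑ i j, |f i j (x i, y j)| ^ p) ^ (1 / p) dx dy`. -/
def decoupledNorm {Ω 𝕜 : Type*} [MeasurableSpace Ω] [RCLike 𝕜] (μ : Measure Ω) (p : ℝ) {n : ℕ}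
    (f : Fin n → Fin n → Ω × Ω → 𝕜) : ℝ≥0∞ :=
  ∫⁻ x : Fin n → Ω, ∫⁻ y : Fin n → Ω,
    (∑ i, ∑ j, ‖f i j (x i, y j)‖ₑ ^ p) ^ (1 / p)
      ∂(Measure.pi fun _ => μ) ∂(Measure.pi fun _ => μ)

/-- The norm in `L¹((∐ i, Ω) × (∐ j, Ω))`. -/
def normL1 {Ω 𝕜 : Type*} [MeasurableSpace Ω] [RCLike 𝕜] (μ : Measure Ω) {n : ℕ}
    (a : Fin n → Fin n → Ω × Ω → 𝕜) : ℝ≥0∞ :=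
  ∑ i, ∑ j, ∫⁻ ξ, ∫⁻ υ, ‖a i j (ξ, υ)‖ₑ ∂μ ∂μ

/-- The norm in `Lᵖ((∐ i, Ω) × (∐ j, Ω))`. -/
def normLp {Ω 𝕜 : Type*} [MeasurableSpace Ω] [RCLike 𝕜] (μ : Measure Ω) (p : ℝ) {n : ℕ}
    (b : Fin n → Fin n → Ω × Ω → 𝕜) : ℝ≥0∞ :=
  (∑ i, ∑ j, ∫⁻ ξ, ∫⁻ υ, ‖b i j (ξ, υ)‖ₑ ^ p ∂μ ∂μ) ^ (1 / p)

/-- The norm in `L¹(∐ i, Ω; Lᵖ(∐ j, Ω))`: the inner `Lᵖ` norm is in the second variable. -/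
def normL1Lp {Ω 𝕜 : Type*} [MeasurableSpace Ω] [RCLike 𝕜] (μ : Measure Ω) (p : ℝ) {n : ℕ}
    (c : Fin n → Fin n → Ω × Ω → 𝕜) : ℝ≥0∞ :=
  ∑ i, ∫⁻ ξ, (∑ j, ∫⁻ υ, ‖c i j (ξ, υ)‖ₑ ^ p ∂μ) ^ (1 / p) ∂μ

/-- The norm in `L¹(∐ j, Ω; Lᵖ(∐ i, Ω))`: the inner `Lᵖ` norm is in the first variable. -/
def normL1LpSwap {Ω 𝕜 : Type*} [MeasurableSpace Ω] [RCLike 𝕜] (μ : Measure Ω) (p : ℝ) {n : ℕ}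
    (d : Fin n → Fin n → Ω × Ω → 𝕜) : ℝ≥0∞ :=
  ∑ j, ∫⁻ υ, (∑ i, ∫⁻ ξ, ‖d i j (ξ, υ)‖ₑ ^ p ∂μ) ^ (1 / p) ∂μ

/-- `f = a + b + c + d` almost everywhere, with (strongly) measurable summands. -/
structure IsDecomposition {Ω 𝕜 : Type*} [MeasurableSpace Ω] [RCLike 𝕜] (μ : Measure Ω) {n : ℕ}
    (f a b c d : Fin n → Fin n → Ω × Ω → 𝕜) : Prop where
  aesm_a : ∀ i j, AEStronglyMeasurable (a i j) (μ.prod μ)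
  aesm_b : ∀ i j, AEStronglyMeasurable (b i j) (μ.prod μ)
  aesm_c : ∀ i j, AEStronglyMeasurable (c i j) (μ.prod μ)
  aesm_d : ∀ i j, AEStronglyMeasurable (d i j) (μ.prod μ)
  eq_add : ∀ i j, ∀ᵐ z ∂(μ.prod μ), f i j z = a i j z + b i j z + c i j z + d i j z

/-- The norm of `f` in the interpolation sum of the four spaces: the infimum over all decompositions
`f = a + b + c + d` of the sum of the four norms. -/
def fourSumNorm {Ω 𝕜 : Type*} [MeasurableSpace Ω] [RCLike 𝕜] (μ : Measure Ω) (p : ℝ) {n : ℕ}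
    (f : Fin n → Fin n → Ω × Ω → 𝕜) : ℝ≥0∞ :=
  ⨅ (a : Fin n → Fin n → Ω × Ω → 𝕜) (b : Fin n → Fin n → Ω × Ω → 𝕜)
    (c : Fin n → Fin n → Ω × Ω → 𝕜) (d : Fin n → Fin n → Ω × Ω → 𝕜)
    (_ : IsDecomposition μ f a b c d),
      normL1 μ a + normLp μ p b + normL1Lp μ p c + normL1LpSwap μ p d

end

/-! The decoupled norm is `E (∑ |f i j (x i, y j)| ^ p) ^ (1 / p)` for independent `x i`, `y j` of
law `μ`.

That it is at most the sum norm follows from Minkowski's inequality and a bound for each of the four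
summands, obtained from `ℓ¹ ⊆ ℓᵖ` and Jensen's inequality applied to both, one or none of the two
variables (`decoupledMean_le_L1`, `decoupledMean_le_Lp`, `decoupledMean_le_L1Lp`). The constant
there is `1`.

For the converse, consider first independent nonnegative `h i (x i)` whose `ℓᵖ` norm has mean at
most `v`. By Markov's inequality it exceeds `128 v` with small probability. The second moment
method (`mean_le_of_second_moment`) turns this into a small bound on the expected number of `i` with
`h i (x i) > 128 v`, and into a bound of order `v ^ p` on the sum of the means of `h i ^ p` over
`{h i ≤ 128 v}`. Since few of the variables exceed the level, their sum over these is comparable in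
mean to their maximum (`sum_lintegral_le_two_mul_lintegral`), and so `h` splits at the level `128 v`
into an `L¹` and an `Lᵖ` part. All constants are independent of `p`, because the variables are only
ever raised to the power `p` after division by the level, and `c ^ (1 / p) ≤ c` for `c ≥ 1`.

Now let the decoupled norm of `g i j = |f i j|` be at most `1`. The mean over `y` of the `ℓᵖ` norm of
row `i`, with `x i = ξ` fixed, is `rowMean i ξ`. The maximum of the `rowMean i (x i)` has mean at
most `1`, so the row means exceeding `128` have bounded integral. In these rows the one-variable
splitting, at a level proportional to the row mean, gives an `L¹` and an `L¹(Lᵖ)` part. Columns are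
treated in the same way. In what remains, `smallMeanPart`, all row and column means are at most
`128`, so by the one-variable estimates all sections are under control at the level `128 * 128`.
This makes the second moment method work for the double sum, as the terms sharing a variable with
a given one contribute little (`sum_erase_lintegral_mul_le`), and splitting at the level
`128 * 128` gives an `L¹` and an `Lᵖ` part. The pieces are level sets of one function,
`pieceLabel`, hence disjoint. -/

/-! ### Two estimates for sums of weakly dependent nonnegative random variables -/

section SecondMoment

variable {Θ : Type*} [MeasurableSpace Θ] {P : Measure Θ} [IsProbabilityMeasure P]

/-- If `W ≥ 0` has mean `m` and variance at most `K m`, and `W` rarely exceeds `t`, then `m` is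
controlled by `t` and `K`. The case `t = 0` counts rare events, the case `t = 1` bounds a sum of
truncated variables. -/
theorem mean_le_of_second_moment {W : Θ → ℝ≥0∞} (hW : Measurable W) {t K m : ℝ≥0}
    (hm : ∫⁻ θ, W θ ∂P = m) (h2 : ∫⁻ θ, W θ ^ 2 ∂P ≤ m ^ 2 + K * m)
    (ht : P {θ | (t : ℝ≥0∞) < W θ} ≤ 1 / 128) : m ≤ 2 * t + K / 8 := by
  rcases eq_or_ne m 0 with rfl | hm0
  · positivity
  have hmpos : 0 < m := pos_iff_ne_zero.2 hm0
  have hmeas : MeasurableSet {θ | (t : ℝ≥0∞) < W θ} := measurableSet_lt measurable_const hW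
  -- the arithmetic-geometric mean inequality on `{t < W}`
  have hpt : ∀ θ, W θ ≤ t + ((16 * m)⁻¹ : ℝ≥0) * W θ ^ 2
      + (4 * m : ℝ≥0) * {θ | (t : ℝ≥0∞) < W θ}.indicator 1 θ := by
    intro θ
    by_cases h : (t : ℝ≥0∞) < W θ
    · rw [Set.indicator_of_mem (by exact h)]
      rcases eq_or_ne (W θ) ⊤ with hT | hT
      · have : ((16 * m)⁻¹ : ℝ≥0) ≠ 0 := by positivity
        simp [hT, ENNReal.mul_top, hm0]
      · lift W θ to ℝ≥0 using hT with w
        simp only [Pi.one_apply, mul_one]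
        norm_cast
        rw [← NNReal.coe_le_coe]
        push_cast
        have hm' : (0 : ℝ) < m := by exact_mod_cast hmpos
        have : (w : ℝ) ≤ (16 * (m : ℝ))⁻¹ * w ^ 2 + 4 * m := by
          have e : (16 * (m : ℝ))⁻¹ * w ^ 2 + 4 * m - w = (16 * (m : ℝ))⁻¹ * (w - 8 * m) ^ 2 := by
            field_simp
            ring
          have : 0 ≤ (16 * (m : ℝ))⁻¹ * (w - 8 * m) ^ 2 := by positivity
          linarith
        linarith [t.coe_nonneg]
    · exact (not_lt.1 h).trans (by rw [add_assoc]; exact le_self_add)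
  have hint : (m : ℝ≥0∞) ≤ t + ((16 * m)⁻¹ : ℝ≥0) * (m ^ 2 + K * m) + (4 * m : ℝ≥0) * (1 / 128) := by
    calc (m : ℝ≥0∞) = ∫⁻ θ, W θ ∂P := hm.symm
      _ ≤ ∫⁻ θ, (t + ((16 * m)⁻¹ : ℝ≥0) * W θ ^ 2
            + (4 * m : ℝ≥0) * {θ | (t : ℝ≥0∞) < W θ}.indicator 1 θ) ∂P := lintegral_mono hpt
      _ = t + ((16 * m)⁻¹ : ℝ≥0) * ∫⁻ θ, W θ ^ 2 ∂P
            + (4 * m : ℝ≥0) * P {θ | (t : ℝ≥0∞) < W θ} := by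
          rw [lintegral_add_left (by fun_prop), lintegral_add_left (by fun_prop),
            lintegral_const_mul _ (by fun_prop),
            lintegral_const_mul _ (measurable_one.indicator hmeas), lintegral_indicator_one hmeas]
          simp
      _ ≤ _ := by gcongr
  have h128 : (1 / 128 : ℝ≥0∞) = ((1 / 128 : ℝ≥0) : ℝ≥0∞) := by
    rw [ENNReal.coe_div (by norm_num)]; simp
  rw [h128] at hint
  norm_cast at hint
  rw [← NNReal.coe_le_coe] at hint ⊢
  push_cast at hint ⊢
  have hm' : (0 : ℝ) < m := by exact_mod_cast hmpos
  have e : (16 * (m : ℝ))⁻¹ * (m ^ 2 + K * m) = m / 16 + K / 16 := by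
    field_simp
  rw [e] at hint
  linarith [t.coe_nonneg, K.coe_nonneg]

omit [IsProbabilityMeasure P] in
/-- A sum of variables, each of which is nonzero only on a rare event, has at most twice the mean of
any common majorant `S`. Here `e k` dominates the indicator of `{a k ≠ 0}`, and `h` says that, when
`a k` is active, the expected number of other active indices is at most `1 / 2`. -/
theorem sum_lintegral_le_two_mul_lintegral {J : Type*} [Fintype J] [DecidableEq J]
    {a : J → Θ → ℝ≥0∞} (ha : ∀ k, Measurable (a k)) {S : Θ → ℝ≥0∞} (haS : ∀ k θ, a k θ ≤ S θ)
    {e : J → Θ → ℝ≥0∞} (he : ∀ k, Measurable (e k)) (hae : ∀ k θ, a k θ ≠ 0 → 1 ≤ e k θ)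
    (h : ∀ k, ∑ l ∈ Finset.univ.erase k, ∫⁻ θ, a k θ * e l θ ∂P ≤ 1 / 2 * ∫⁻ θ, a k θ ∂P) :
    ∑ k, ∫⁻ θ, a k θ ∂P ≤ 2 * ∫⁻ θ, S θ ∂P := by
  rcases eq_or_ne (∫⁻ θ, S θ ∂P) ⊤ with hT | hT
  · simp [hT]
  -- If no `a k θ` is the only nonzero one, the double sum alone dominates the left hand side.
  have hpt : ∀ θ, ∑ k, a k θ ≤ S θ + ∑ k, ∑ l ∈ Finset.univ.erase k, a k θ * e l θ := by
    intro θ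
    by_cases h1 : ∃ k, a k θ ≠ 0 ∧ ∀ l ≠ k, a l θ = 0
    · obtain ⟨k, -, hk⟩ := h1
      rw [Finset.sum_eq_single k (fun l _ hl => hk l hl) (by simp)]
      exact (haS k θ).trans le_self_add
    · push Not at h1
      refine le_add_left (Finset.sum_le_sum fun k _ => ?_)
      rcases eq_or_ne (a k θ) 0 with h0 | h0
      · simp [h0]
      · obtain ⟨l, hl, hl0⟩ := h1 k h0
        calc a k θ ≤ a k θ * e l θ := le_mul_of_one_le_right' (hae l θ hl0)
          _ ≤ _ := Finset.single_le_sum (f := fun l => a k θ * e l θ) (fun _ _ => zero_le)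
            (by simp [hl])
  have hsum : ∑ k, ∫⁻ θ, a k θ ∂P ≤ ∫⁻ θ, S θ ∂P + 1 / 2 * ∑ k, ∫⁻ θ, a k θ ∂P := by
    calc ∑ k, ∫⁻ θ, a k θ ∂P = ∫⁻ θ, ∑ k, a k θ ∂P :=
          (lintegral_finsetSum _ fun k _ => ha k).symm
      _ ≤ ∫⁻ θ, (S θ + ∑ k, ∑ l ∈ Finset.univ.erase k, a k θ * e l θ) ∂P := lintegral_mono hpt
      _ = ∫⁻ θ, S θ ∂P + ∑ k, ∑ l ∈ Finset.univ.erase k, ∫⁻ θ, a k θ * e l θ ∂P := by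
          rw [lintegral_add_right _ (by fun_prop), lintegral_finsetSum _ (by fun_prop)]
          congr 1
          refine Finset.sum_congr rfl fun k _ => ?_
          rw [lintegral_finsetSum _ (by fun_prop)]
      _ ≤ _ := by
          rw [Finset.mul_sum]
          gcongr with k
          exact h k
  have hfin : ∑ k, ∫⁻ θ, a k θ ∂P ≠ ⊤ := by
    refine ENNReal.sum_ne_top.2 fun k _ => ne_top_of_le_ne_top hT (lintegral_mono (haS k))
  lift ∑ k, ∫⁻ θ, a k θ ∂P to ℝ≥0 using hfin with A
  lift ∫⁻ θ, S θ ∂P to ℝ≥0 using hT with B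
  have h12 : (1 / 2 : ℝ≥0∞) = ((1 / 2 : ℝ≥0) : ℝ≥0∞) := by
    rw [ENNReal.coe_div (by norm_num)]; simp
  rw [h12] at hsum
  norm_cast at hsum ⊢
  rw [← NNReal.coe_le_coe] at hsum ⊢
  push_cast at hsum ⊢
  linarith

end SecondMoment

/-! ### Sums of functions of independent variables -/

section OneVariable

variable {Ω : Type*} [MeasurableSpace Ω] {μ : Measure Ω} [IsProbabilityMeasure μ]
  {ι : Type*} [Fintype ι]

theorem lintegral_pi_eval (i : ι) {φ : Ω → ℝ≥0∞} (hφ : Measurable φ) :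
    ∫⁻ x : ι → Ω, φ (x i) ∂(Measure.pi fun _ => μ) = ∫⁻ ξ, φ ξ ∂μ :=
  (measurePreserving_eval (fun _ : ι => μ) i).lintegral_comp hφ

theorem lintegral_pi_eval_mul_eval {i k : ι} (hik : i ≠ k) {φ ψ : Ω → ℝ≥0∞} (hφ : Measurable φ)
    (hψ : Measurable ψ) :
    ∫⁻ x : ι → Ω, φ (x i) * ψ (x k) ∂(Measure.pi fun _ => μ)
      = (∫⁻ ξ, φ ξ ∂μ) * ∫⁻ ξ, ψ ξ ∂μ := by
  classical
  have hind := ProbabilityTheory.iIndepFun_pi (μ := fun _ : ι => μ) (X := fun _ ω => ω)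
    (fun _ => aemeasurable_id)
  have h2 := (hind.indepFun hik).comp hφ hψ
  have := ProbabilityTheory.lintegral_mul_eq_lintegral_mul_lintegral_of_indepFun
    (hφ.comp (measurable_pi_apply i)) (hψ.comp (measurable_pi_apply k)) h2
  rw [← lintegral_pi_eval (μ := μ) i hφ, ← lintegral_pi_eval (μ := μ) k hψ]
  exact this

/-- Markov's inequality at level `128 v`; the tail `1 / 128` is the one required by
`mean_le_of_second_moment`. -/
theorem measure_lt_le_of_lintegral_le {Θ : Type*} [MeasurableSpace Θ] {P : Measure Θ}
    {S : Θ → ℝ≥0∞} (hS : Measurable S) {v : ℝ≥0} (hv : v ≠ 0) (h : ∫⁻ θ, S θ ∂P ≤ v) :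
    P {θ | (128 * v : ℝ≥0∞) < S θ} ≤ 1 / 128 := by
  have hm := mul_meas_ge_le_lintegral (μ := P) hS (128 * v)
  have hle : P {θ | (128 * v : ℝ≥0∞) < S θ} ≤ P {θ | (128 * v : ℝ≥0∞) ≤ S θ} :=
    by
    refine measure_mono fun θ hθ => ?_
    simp only [Set.mem_ofPred_eq] at hθ ⊢
    exact hθ.le
  refine hle.trans ?_
  have h3 := hm.trans h
  rw [ENNReal.le_div_iff_mul_le (by simp) (by simp)]
  have h4 : (v : ℝ≥0∞) * (P {θ | (128 * v : ℝ≥0∞) ≤ S θ} * 128) ≤ v * 1 := by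
    calc _ = 128 * v * P {θ | (128 * v : ℝ≥0∞) ≤ S θ} := by ring
      _ ≤ _ := by rwa [mul_one]
  exact (ENNReal.mul_le_mul_iff_right (by simpa using hv) ENNReal.coe_ne_top).1 h4

/-- A sum of independent `[0, 1]`-valued variables has variance at most its mean. -/
theorem sum_lintegral_le_of_measure_lt_le {w : ι → Ω → ℝ≥0∞} (hw : ∀ i, Measurable (w i))
    (hw1 : ∀ i ξ, w i ξ ≤ 1) {t : ℝ≥0}
    (h : Measure.pi (fun _ : ι => μ) {x | (t : ℝ≥0∞) < ∑ i, w i (x i)} ≤ 1 / 128) :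
    ∑ i, ∫⁻ ξ, w i ξ ∂μ ≤ (2 * t + 1 / 8 : ℝ≥0) := by
  classical
  have hfin : ∑ i, ∫⁻ ξ, w i ξ ∂μ ≠ ⊤ := ENNReal.sum_ne_top.2 fun i _ =>
    ne_top_of_le_ne_top (b := 1) (by simp) ((lintegral_mono (hw1 i)).trans (by simp))
  have hm : ∫⁻ x : ι → Ω, ∑ i, w i (x i) ∂(Measure.pi fun _ => μ) = ∑ i, ∫⁻ ξ, w i ξ ∂μ := by
    rw [lintegral_finsetSum _ (by fun_prop)]
    exact Finset.sum_congr rfl fun i _ => lintegral_pi_eval i (hw i)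
  have h2 : ∫⁻ x : ι → Ω, (∑ i, w i (x i)) ^ 2 ∂(Measure.pi fun _ => μ)
      ≤ (∑ i, ∫⁻ ξ, w i ξ ∂μ) ^ 2 + 1 * ∑ i, ∫⁻ ξ, w i ξ ∂μ := by
    simp_rw [pow_two, Finset.sum_mul_sum]
    rw [lintegral_finsetSum _ (by fun_prop), one_mul, ← Finset.sum_add_distrib]
    refine Finset.sum_le_sum fun i _ => ?_
    rw [lintegral_finsetSum _ (by fun_prop), ← Finset.add_sum_erase _ _ (Finset.mem_univ i),
      add_comm]
    refine add_le_add ?_ ?_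
    · calc _ = ∑ k ∈ Finset.univ.erase i, (∫⁻ ξ, w i ξ ∂μ) * ∫⁻ ξ, w k ξ ∂μ :=
            Finset.sum_congr rfl fun k hk =>
              lintegral_pi_eval_mul_eval (Finset.ne_of_mem_erase hk).symm (hw i) (hw k)
        _ ≤ _ := Finset.sum_le_sum_of_subset (Finset.erase_subset _ _)
    · rw [← lintegral_pi_eval (μ := μ) i (hw i)]
      exact lintegral_mono fun x => mul_le_of_le_one_right' (hw1 i (x i))
  generalize ∑ i, ∫⁻ ξ, w i ξ ∂μ = M at hfin hm h2 ⊢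
  lift M to ℝ≥0 using hfin
  have := mean_le_of_second_moment (K := 1) (by fun_prop) hm (by simpa using h2) h
  exact_mod_cast this

/-- If the maximum of independent variables has mean at most `v`, then the expected number of those
exceeding `128 v` is at most `1 / 8`. -/
theorem sum_measure_lt_le {h : ι → Ω → ℝ≥0∞} (hh : ∀ i, Measurable (h i)) {S : (ι → Ω) → ℝ≥0∞}
    (hS : Measurable S) (hle : ∀ x i, h i (x i) ≤ S x) {v : ℝ≥0} (hv : v ≠ 0)
    (hSv : ∫⁻ x, S x ∂(Measure.pi fun _ => μ) ≤ v) :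
    ∑ i, μ {ξ | (128 * v : ℝ≥0∞) < h i ξ} ≤ (1 / 8 : ℝ≥0) := by
  have hms : ∀ i, MeasurableSet {ξ | (128 * v : ℝ≥0∞) < h i ξ} := fun i =>
    measurableSet_lt measurable_const (hh i)
  have := sum_lintegral_le_of_measure_lt_le (μ := μ)
    (w := fun i => {ξ | (128 * v : ℝ≥0∞) < h i ξ}.indicator 1) (t := 0)
    (fun i => measurable_one.indicator (hms i))
    (fun i ξ => Set.indicator_le_self' (by simp) ξ)
    (by
      refine le_trans (measure_mono fun x hx => ?_) (measure_lt_le_of_lintegral_le hS hv hSv)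
      simp only [ENNReal.coe_zero, Set.mem_ofPred_eq, pos_iff_ne_zero, ne_eq,
        Finset.sum_eq_zero_iff, not_forall] at hx
      obtain ⟨i, -, hi⟩ := hx
      have hi' : x i ∈ {ξ | (128 * v : ℝ≥0∞) < h i ξ} := Set.mem_of_indicator_ne_zero hi
      exact lt_of_lt_of_le hi' (hle x i))
  simpa [lintegral_indicator_one (hms _)] using this

/-- If the maximum of independent variables has mean at most `v`, then the parts above the level
`128 v` have total mean at most `2 v`. Together with `sum_lintegral_indicator_le_rpow_le` this is
the splitting into an `L¹` and an `Lᵖ` part for one family of independent variables. -/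
theorem sum_lintegral_indicator_lt_le {h : ι → Ω → ℝ≥0∞} (hh : ∀ i, Measurable (h i))
    {S : (ι → Ω) → ℝ≥0∞} (hS : Measurable S) (hle : ∀ x i, h i (x i) ≤ S x) {v : ℝ≥0∞} (hv : v ≠ 0)
    (hSv : ∫⁻ x, S x ∂(Measure.pi fun _ => μ) ≤ v) :
    ∑ i, ∫⁻ ξ, {ξ | 128 * v < h i ξ}.indicator (h i) ξ ∂μ ≤ 2 * v := by
  classical
  rcases eq_or_ne v ⊤ with rfl | hvT
  · simp
  lift v to ℝ≥0 using hvT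
  have hms : ∀ i, MeasurableSet {ξ | (128 * v : ℝ≥0∞) < h i ξ} := fun i =>
    measurableSet_lt measurable_const (hh i)
  have hcount := sum_measure_lt_le hh hS hle (by simpa using hv) hSv
  have hma : ∀ i, Measurable ({ξ | (128 * v : ℝ≥0∞) < h i ξ}.indicator (h i)) := fun i =>
    (hh i).indicator (hms i)
  have hme : ∀ i, Measurable ({ξ | (128 * v : ℝ≥0∞) < h i ξ}.indicator (1 : Ω → ℝ≥0∞)) := fun i =>
    measurable_one.indicator (hms i)
  have := sum_lintegral_le_two_mul_lintegral (P := Measure.pi fun _ : ι => μ)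
    (a := fun i x => {ξ | (128 * v : ℝ≥0∞) < h i ξ}.indicator (h i) (x i)) (S := S)
    (e := fun i x => {ξ | (128 * v : ℝ≥0∞) < h i ξ}.indicator 1 (x i))
    (fun i => (hma i).comp (measurable_pi_apply i))
    (fun i x => (Set.indicator_le_self _ _ _).trans (hle x i))
    (fun i => (hme i).comp (measurable_pi_apply i))
    (fun i x hx => by rw [Set.indicator_of_mem (Set.mem_of_indicator_ne_zero hx)]; rfl)
    (fun i => by
      rw [lintegral_pi_eval i (hma i)]
      calc _ = ∑ k ∈ Finset.univ.erase i,
            (∫⁻ ξ, {ξ | (128 * v : ℝ≥0∞) < h i ξ}.indicator (h i) ξ ∂μ)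
              * μ {ξ | (128 * v : ℝ≥0∞) < h k ξ} :=
            Finset.sum_congr rfl fun k hk => by
              rw [lintegral_pi_eval_mul_eval (Finset.ne_of_mem_erase hk).symm (hma i) (hme k),
                lintegral_indicator_one (hms k)]
        _ ≤ (∫⁻ ξ, {ξ | (128 * v : ℝ≥0∞) < h i ξ}.indicator (h i) ξ ∂μ)
              * ∑ k, μ {ξ | (128 * v : ℝ≥0∞) < h k ξ} := by
            rw [← Finset.mul_sum]
            gcongr
            exact Finset.erase_subset _ _
        _ ≤ (∫⁻ ξ, {ξ | (128 * v : ℝ≥0∞) < h i ξ}.indicator (h i) ξ ∂μ) * (1 / 2) := by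
            gcongr
            refine hcount.trans ?_
            rw [show (1 / 2 : ℝ≥0∞) = ((1 / 2 : ℝ≥0) : ℝ≥0∞) by
              rw [ENNReal.coe_div (by norm_num)]; simp]
            rw [ENNReal.coe_le_coe, ← NNReal.coe_le_coe]
            norm_num
        _ = _ := mul_comm _ _)
  calc _ = ∑ i, ∫⁻ x : ι → Ω, {ξ | (128 * v : ℝ≥0∞) < h i ξ}.indicator (h i) (x i)
            ∂(Measure.pi fun _ => μ) :=
        Finset.sum_congr rfl fun i _ => (lintegral_pi_eval i (hma i)).symm
    _ ≤ _ := this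
    _ ≤ _ := by gcongr

theorem indicator_le_div_rpow_le_one {α : Type*} {h : α → ℝ≥0∞} {L : ℝ≥0∞} {p : ℝ} (hp : 0 < p)
    (z : α) : ({z | h z ≤ L}.indicator h z / L) ^ p ≤ 1 := by
  refine ENNReal.rpow_le_one (ENNReal.div_le_of_le_mul ?_) hp.le
  rw [one_mul]
  by_cases hz : h z ≤ L
  · rwa [Set.indicator_of_mem (by exact hz)]
  · rw [Set.indicator_of_notMem (by exact hz)]; exact zero_le

theorem lt_rpow_of_one_lt_sum_div_rpow {J : Type*} [Fintype J] {s t : J → ℝ≥0∞}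
    (hts : ∀ k, t k ≤ s k) {p : ℝ} (hp : 0 < p) {L : ℝ≥0∞} (hL0 : L ≠ 0) (hLT : L ≠ ⊤)
    (h : 1 < ∑ k, (t k / L) ^ p) : L < (∑ k, s k ^ p) ^ (1 / p) := by
  simp_rw [ENNReal.div_rpow_of_nonneg _ _ hp.le, div_eq_mul_inv, ← Finset.sum_mul] at h
  rw [← div_eq_mul_inv, ENNReal.lt_div_iff_mul_lt (by simp [hLT, hL0]) (by simp [hLT, hL0]),
    one_mul] at h
  rw [one_div, ENNReal.lt_rpow_inv_iff hp]
  exact h.trans_le (Finset.sum_le_sum fun k _ => ENNReal.rpow_le_rpow (hts k) hp.le)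

/-- If the `ℓᵖ` norm of independent variables has mean at most `v`, then the parts below the level
`128 v` have `Lᵖ` norm of order `v`. -/
theorem sum_lintegral_indicator_le_rpow_le {h : ι → Ω → ℝ≥0∞} (hh : ∀ i, Measurable (h i))
    {p : ℝ} (hp : 1 ≤ p) {v : ℝ≥0∞} (hv : v ≠ 0)
    (hSv : ∫⁻ x : ι → Ω, (∑ i, h i (x i) ^ p) ^ (1 / p) ∂(Measure.pi fun _ => μ) ≤ v) :
    ∑ i, ∫⁻ ξ, ({ξ | h i ξ ≤ 128 * v}.indicator (h i) ξ) ^ p ∂μ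
      ≤ (17 / 8 : ℝ≥0) * (128 * v) ^ p := by
  have hp0 : 0 < p := zero_lt_one.trans_le hp
  rcases eq_or_ne v ⊤ with rfl | hvT
  · have h128 : (128 : ℝ≥0∞) ≠ 0 := by norm_num
    rw [ENNReal.mul_top h128, ENNReal.top_rpow_of_pos hp0, ENNReal.mul_top (by simp)]
    exact le_top
  lift v to ℝ≥0 using hvT
  set L : ℝ≥0∞ := 128 * v with hL
  have hL0 : L ≠ 0 := by simpa [hL] using hv
  have hLT : L ≠ ⊤ := by simp [hL, ENNReal.mul_eq_top]
  have hma : ∀ i, Measurable ({ξ | h i ξ ≤ L}.indicator (h i)) := fun i =>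
    (hh i).indicator (measurableSet_le (hh i) measurable_const)
  have key := sum_lintegral_le_of_measure_lt_le (μ := μ)
    (w := fun i ξ => ({ξ | h i ξ ≤ L}.indicator (h i) ξ / L) ^ p) (t := 1)
    (fun i => ((hma i).div_const L).pow_const p)
    (fun i ξ => indicator_le_div_rpow_le_one hp0 ξ)
    (by
      refine le_trans (measure_mono fun x hx => ?_)
        (measure_lt_le_of_lintegral_le (by fun_prop) (by simpa using hv) hSv)
      exact lt_rpow_of_one_lt_sum_div_rpow (fun i => Set.indicator_le_self _ _ _) hp0 hL0 hLT hx)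
  have hL0p : L ^ p ≠ 0 := by simp [hL0, hLT]
  have hLTp : L ^ p ≠ ⊤ := by simp [hL0, hLT]
  have e : ∑ i, ∫⁻ ξ, ({ξ | h i ξ ≤ L}.indicator (h i) ξ / L) ^ p ∂μ
      = (∑ i, ∫⁻ ξ, ({ξ | h i ξ ≤ L}.indicator (h i) ξ) ^ p ∂μ) / L ^ p := by
    simp_rw [ENNReal.div_rpow_of_nonneg _ _ hp0.le, div_eq_mul_inv]
    rw [Finset.sum_mul]
    refine Finset.sum_congr rfl fun i _ => ?_
    rw [lintegral_mul_const _ ((hma i).pow_const p)]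
  rw [e, ENNReal.div_le_iff hL0p hLTp] at key
  refine key.trans (le_of_eq ?_)
  congr 2
  norm_num

end OneVariable

/-! ### Sums over pairs of independent variables -/

section TwoVariables

variable {Ω : Type*} [MeasurableSpace Ω] {μ : Measure Ω} [IsProbabilityMeasure μ]
  {ι κ : Type*} [Fintype ι] [Fintype κ]

theorem measurePreserving_eval_prodMap (μ : Measure Ω) [IsProbabilityMeasure μ] (i : ι) (j : κ) :
    MeasurePreserving (fun θ : (ι → Ω) × (κ → Ω) => (θ.1 i, θ.2 j))
      ((Measure.pi fun _ => μ).prod (Measure.pi fun _ => μ)) (μ.prod μ) :=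
  (measurePreserving_eval (fun _ : ι => μ) i).prod (measurePreserving_eval (fun _ : κ => μ) j)

theorem lintegral_pi_prod_eval (i : ι) (j : κ) {φ : Ω × Ω → ℝ≥0∞} (hφ : Measurable φ) :
    ∫⁻ θ : (ι → Ω) × (κ → Ω), φ (θ.1 i, θ.2 j)
      ∂((Measure.pi fun _ => μ).prod (Measure.pi fun _ => μ)) = ∫⁻ z, φ z ∂(μ.prod μ) :=
  (measurePreserving_eval_prodMap μ i j).lintegral_comp hφ

theorem lintegral_eval_mul_of_snd_ne (i k : ι) {j l : κ} (hjl : j ≠ l) {w v : Ω × Ω → ℝ≥0∞}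
    (hw : Measurable w) (hv : Measurable v) :
    ∫⁻ θ : (ι → Ω) × (κ → Ω), w (θ.1 i, θ.2 j) * v (θ.1 k, θ.2 l)
        ∂((Measure.pi fun _ => μ).prod (Measure.pi fun _ => μ))
      = ∫⁻ x : ι → Ω, (∫⁻ υ, w (x i, υ) ∂μ) * (∫⁻ υ, v (x k, υ) ∂μ) ∂(Measure.pi fun _ => μ) := by
  rw [lintegral_prod _ (by fun_prop)]
  exact lintegral_congr fun x => lintegral_pi_eval_mul_eval (φ := fun υ => w (x i, υ))
    (ψ := fun υ => v (x k, υ)) hjl (by fun_prop) (by fun_prop)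

theorem lintegral_eval_mul_of_fst_ne {i k : ι} (hik : i ≠ k) (j l : κ) {w v : Ω × Ω → ℝ≥0∞}
    (hw : Measurable w) (hv : Measurable v) :
    ∫⁻ θ : (ι → Ω) × (κ → Ω), w (θ.1 i, θ.2 j) * v (θ.1 k, θ.2 l)
        ∂((Measure.pi fun _ => μ).prod (Measure.pi fun _ => μ))
      = ∫⁻ y : κ → Ω, (∫⁻ ξ, w (ξ, y j) ∂μ) * (∫⁻ ξ, v (ξ, y l) ∂μ) ∂(Measure.pi fun _ => μ) := by
  rw [lintegral_prod_symm _ (by fun_prop)]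
  exact lintegral_congr fun y => lintegral_pi_eval_mul_eval (φ := fun ξ => w (ξ, y j))
    (ψ := fun ξ => v (ξ, y l)) hik (by fun_prop) (by fun_prop)

/-- The correlation of `w (x i, y j)` with all the other `v k l (x k, y l)`. Terms sharing no variable
with the first factor are independent of it; those sharing `x i` or `y j` are controlled by the
bound `δ` on the sections of `v`. -/
theorem sum_erase_lintegral_mul_le [DecidableEq ι] [DecidableEq κ] {w : Ω × Ω → ℝ≥0∞}
    (hw : Measurable w)
    {v : ι → κ → Ω × Ω → ℝ≥0∞} (hv : ∀ k l, Measurable (v k l)) {δ : ℝ≥0∞}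
    (hfst : ∀ k ξ, ∑ l, ∫⁻ υ, v k l (ξ, υ) ∂μ ≤ δ) (hsnd : ∀ l υ, ∑ k, ∫⁻ ξ, v k l (ξ, υ) ∂μ ≤ δ)
    (i : ι) (j : κ) :
    ∑ q ∈ Finset.univ.erase (i, j), ∫⁻ θ : (ι → Ω) × (κ → Ω),
        w (θ.1 i, θ.2 j) * v q.1 q.2 (θ.1 q.1, θ.2 q.2)
        ∂((Measure.pi fun _ => μ).prod (Measure.pi fun _ => μ))
      ≤ (∑ k, ∑ l, ∫⁻ z, v k l z ∂(μ.prod μ) + 2 * δ) * ∫⁻ z, w z ∂(μ.prod μ) := by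
  set m := ∫⁻ z, w z ∂(μ.prod μ) with hm
  have hw1m : Measurable fun ξ => ∫⁻ υ, w (ξ, υ) ∂μ := hw.lintegral_prod_right'
  have hw2m : Measurable fun υ => ∫⁻ ξ, w (ξ, υ) ∂μ := hw.lintegral_prod_left'
  have hm1 : m = ∫⁻ ξ, ∫⁻ υ, w (ξ, υ) ∂μ ∂μ := lintegral_prod _ hw.aemeasurable
  have hm2 : m = ∫⁻ υ, ∫⁻ ξ, w (ξ, υ) ∂μ ∂μ := lintegral_prod_symm _ hw.aemeasurable
  have hterm : ∀ q ∈ Finset.univ.erase (i, j), ∫⁻ θ : (ι → Ω) × (κ → Ω),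
        w (θ.1 i, θ.2 j) * v q.1 q.2 (θ.1 q.1, θ.2 q.2)
        ∂((Measure.pi fun _ => μ).prod (Measure.pi fun _ => μ))
      ≤ m * ∫⁻ z, v q.1 q.2 z ∂(μ.prod μ)
        + (if q.1 = i then ∫⁻ ξ, (∫⁻ υ, w (ξ, υ) ∂μ) * (∫⁻ υ, v i q.2 (ξ, υ) ∂μ) ∂μ else 0)
        + (if q.2 = j then ∫⁻ υ, (∫⁻ ξ, w (ξ, υ) ∂μ) * (∫⁻ ξ, v q.1 j (ξ, υ) ∂μ) ∂μ else 0) := by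
    rintro ⟨k, l⟩ hq
    rw [Finset.mem_erase, ne_eq, Prod.mk.injEq, not_and_or] at hq
    dsimp only
    by_cases hl : l = j
    · have hk : i ≠ k := fun h => hq.1.elim (fun h' => h' h.symm) (fun h' => h' hl)
      subst hl
      rw [lintegral_eval_mul_of_fst_ne hk l l hw (hv k l), if_pos rfl]
      refine le_add_left (le_of_eq ?_)
      exact lintegral_pi_eval (μ := μ) l
        (φ := fun υ => (∫⁻ ξ, w (ξ, υ) ∂μ) * (∫⁻ ξ, v k l (ξ, υ) ∂μ))
        ((hw.lintegral_prod_left').mul (hv k l).lintegral_prod_left')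
    · rw [lintegral_eval_mul_of_snd_ne i k (Ne.symm hl) hw (hv k l)]
      by_cases hk : k = i
      · subst hk
        rw [if_pos rfl]
        refine le_add_right (le_add_left (le_of_eq ?_))
        exact lintegral_pi_eval (μ := μ) k
          (φ := fun ξ => (∫⁻ υ, w (ξ, υ) ∂μ) * (∫⁻ υ, v k l (ξ, υ) ∂μ))
          ((hw.lintegral_prod_right').mul (hv k l).lintegral_prod_right')
      · rw [add_assoc]
        refine le_add_right (le_of_eq ?_)
        rw [hm1, lintegral_prod _ (hv k l).aemeasurable]
        exact lintegral_pi_eval_mul_eval (μ := μ) (Ne.symm hk)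
          (φ := fun ξ => ∫⁻ υ, w (ξ, υ) ∂μ) (ψ := fun ξ => ∫⁻ υ, v k l (ξ, υ) ∂μ)
          hw.lintegral_prod_right' (hv k l).lintegral_prod_right'
  refine (Finset.sum_le_sum hterm).trans
    ((Finset.sum_le_sum_of_subset (Finset.erase_subset _ _)).trans ?_)
  rw [Finset.sum_add_distrib, Finset.sum_add_distrib, Fintype.sum_prod_type, Fintype.sum_prod_type,
    Fintype.sum_prod_type]
  have e2 : (∑ k : ι, ∑ l : κ, if k = i then
      ∫⁻ ξ, (∫⁻ υ, w (ξ, υ) ∂μ) * (∫⁻ υ, v i l (ξ, υ) ∂μ) ∂μ else 0) ≤ δ * m := by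
    rw [Finset.sum_comm]
    simp only [Finset.sum_ite_eq', Finset.mem_univ, if_true]
    rw [← lintegral_finsetSum _ fun l _ => hw1m.fun_mul (hv i l).lintegral_prod_right', hm1, mul_comm,
      ← lintegral_mul_const _ hw.lintegral_prod_right']
    refine lintegral_mono fun ξ => ?_
    rw [← Finset.mul_sum]
    gcongr
    exact hfst i ξ
  have e3 : (∑ k : ι, ∑ l : κ, if l = j then
      ∫⁻ υ, (∫⁻ ξ, w (ξ, υ) ∂μ) * (∫⁻ ξ, v k j (ξ, υ) ∂μ) ∂μ else 0) ≤ δ * m := by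
    simp only [Finset.sum_ite_eq', Finset.mem_univ, if_true]
    rw [← lintegral_finsetSum _ fun k _ => hw2m.fun_mul (hv k j).lintegral_prod_left', hm2, mul_comm,
      ← lintegral_mul_const _ hw.lintegral_prod_left']
    refine lintegral_mono fun υ => ?_
    rw [← Finset.mul_sum]
    gcongr
    exact hsnd j υ
  refine (add_le_add (add_le_add_right e2 _) e3).trans (le_of_eq ?_)
  simp_rw [← Finset.mul_sum]
  ring

/-- The two-variable form of `sum_lintegral_le_of_measure_lt_le`: bounded sections keep the variance
of order of the mean. -/
theorem sum_sum_lintegral_le_of_measure_lt_le {w : ι → κ → Ω × Ω → ℝ≥0∞}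
    (hw : ∀ k l, Measurable (w k l)) (hw1 : ∀ k l z, w k l z ≤ 1) {δ t : ℝ≥0}
    (hfst : ∀ k ξ, ∑ l, ∫⁻ υ, w k l (ξ, υ) ∂μ ≤ δ) (hsnd : ∀ l υ, ∑ k, ∫⁻ ξ, w k l (ξ, υ) ∂μ ≤ δ)
    (h : (Measure.pi fun _ : ι => μ).prod (Measure.pi fun _ : κ => μ)
      {θ | (t : ℝ≥0∞) < ∑ q : ι × κ, w q.1 q.2 (θ.1 q.1, θ.2 q.2)} ≤ 1 / 128) :
    ∑ k, ∑ l, ∫⁻ z, w k l z ∂(μ.prod μ) ≤ (2 * t + (1 + 2 * δ) / 8 : ℝ≥0) := by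
  classical
  have hmeas : ∀ q : ι × κ, Measurable fun θ : (ι → Ω) × (κ → Ω) =>
      w q.1 q.2 (θ.1 q.1, θ.2 q.2) := fun q => by fun_prop
  have hfin : ∑ k, ∑ l, ∫⁻ z, w k l z ∂(μ.prod μ) ≠ ⊤ := ENNReal.sum_ne_top.2 fun k _ =>
    ENNReal.sum_ne_top.2 fun l _ =>
    ne_top_of_le_ne_top (b := 1) (by simp) ((lintegral_mono (hw1 k l)).trans (by simp))
  have hm : ∫⁻ θ : (ι → Ω) × (κ → Ω), ∑ q : ι × κ, w q.1 q.2 (θ.1 q.1, θ.2 q.2)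
      ∂((Measure.pi fun _ => μ).prod (Measure.pi fun _ => μ))
      = ∑ k, ∑ l, ∫⁻ z, w k l z ∂(μ.prod μ) := by
    rw [lintegral_finsetSum _ fun q _ => hmeas q, Fintype.sum_prod_type]
    exact Finset.sum_congr rfl fun k _ => Finset.sum_congr rfl fun l _ =>
      lintegral_pi_prod_eval k l (hw k l)
  have h2 : ∫⁻ θ : (ι → Ω) × (κ → Ω), (∑ q : ι × κ, w q.1 q.2 (θ.1 q.1, θ.2 q.2)) ^ 2
      ∂((Measure.pi fun _ => μ).prod (Measure.pi fun _ => μ))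
      ≤ (∑ k, ∑ l, ∫⁻ z, w k l z ∂(μ.prod μ)) ^ 2
        + (1 + 2 * δ) * ∑ k, ∑ l, ∫⁻ z, w k l z ∂(μ.prod μ) := by
    have hterm : ∀ q : ι × κ, ∫⁻ θ : (ι → Ω) × (κ → Ω), ∑ q' : ι × κ,
        w q.1 q.2 (θ.1 q.1, θ.2 q.2) * w q'.1 q'.2 (θ.1 q'.1, θ.2 q'.2)
        ∂((Measure.pi fun _ => μ).prod (Measure.pi fun _ => μ))
        ≤ (∑ k, ∑ l, ∫⁻ z, w k l z ∂(μ.prod μ) + 2 * δ + 1)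
          * ∫⁻ z, w q.1 q.2 z ∂(μ.prod μ) := by
      intro q
      rw [lintegral_finsetSum _ fun q' _ => (hmeas q).fun_mul (hmeas q'),
        ← Finset.add_sum_erase _ _ (Finset.mem_univ q), add_comm, add_mul, one_mul]
      refine add_le_add (sum_erase_lintegral_mul_le (hw q.1 q.2) hw hfst hsnd q.1 q.2) ?_
      rw [← lintegral_pi_prod_eval (μ := μ) q.1 q.2 (hw q.1 q.2)]
      exact lintegral_mono fun θ => mul_le_of_le_one_right' (hw1 _ _ _)
    rw [lintegral_congr fun θ => by rw [pow_two, Finset.sum_mul_sum],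
      lintegral_finsetSum _ fun q _ => Finset.measurable_fun_sum _ fun q' _ =>
      (hmeas q).fun_mul (hmeas q')]
    refine (Finset.sum_le_sum fun q _ => hterm q).trans (le_of_eq ?_)
    rw [← Finset.mul_sum, Fintype.sum_prod_type]
    ring
  generalize ∑ k, ∑ l, ∫⁻ z, w k l z ∂(μ.prod μ) = M at hfin hm h2 ⊢
  lift M to ℝ≥0 using hfin
  have := mean_le_of_second_moment (K := 1 + 2 * δ) (by fun_prop) hm (by simpa using h2) h
  exact_mod_cast this

/-- The two-variable form of `sum_lintegral_indicator_lt_le`, under a smallness hypothesis on the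
sections. -/
theorem sum_sum_lintegral_indicator_lt_le {g : ι → κ → Ω × Ω → ℝ≥0∞}
    (hg : ∀ k l, Measurable (g k l)) {L : ℝ≥0∞} {S : (ι → Ω) × (κ → Ω) → ℝ≥0∞}
    (hle : ∀ k l θ, g k l (θ.1 k, θ.2 l) ≤ S θ)
    (hS : (Measure.pi fun _ : ι => μ).prod (Measure.pi fun _ : κ => μ) {θ | L < S θ} ≤ 1 / 128)
    (hfst : ∀ k ξ, ∑ l, μ {υ | L < g k l (ξ, υ)} ≤ (1 / 8 : ℝ≥0))
    (hsnd : ∀ l υ, ∑ k, μ {ξ | L < g k l (ξ, υ)} ≤ (1 / 8 : ℝ≥0)) :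
    ∑ k, ∑ l, ∫⁻ z, {z | L < g k l z}.indicator (g k l) z ∂(μ.prod μ)
      ≤ 2 * ∫⁻ θ, S θ ∂((Measure.pi fun _ => μ).prod (Measure.pi fun _ => μ)) := by
  classical
  set e : ι → κ → Ω × Ω → ℝ≥0∞ := fun k l => {z | L < g k l z}.indicator 1 with he
  have hms : ∀ k l, MeasurableSet {z | L < g k l z} := fun k l =>
    measurableSet_lt measurable_const (hg k l)
  have hem : ∀ k l, Measurable (e k l) := fun k l => measurable_one.indicator (hms k l)
  have ham : ∀ k l, Measurable ({z | L < g k l z}.indicator (g k l)) := fun k l =>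
    (hg k l).indicator (hms k l)
  have hfst' : ∀ k ξ, ∑ l, ∫⁻ υ, e k l (ξ, υ) ∂μ ≤ (1 / 8 : ℝ≥0) := fun k ξ => by
    refine le_trans (le_of_eq (Finset.sum_congr rfl fun l _ => ?_)) (hfst k ξ)
    exact lintegral_indicator_one (s := {υ | L < g k l (ξ, υ)})
      (measurableSet_lt measurable_const (by fun_prop))
  have hsnd' : ∀ l υ, ∑ k, ∫⁻ ξ, e k l (ξ, υ) ∂μ ≤ (1 / 8 : ℝ≥0) := fun l υ => by
    refine le_trans (le_of_eq (Finset.sum_congr rfl fun k _ => ?_)) (hsnd l υ)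
    exact lintegral_indicator_one (s := {ξ | L < g k l (ξ, υ)})
      (measurableSet_lt measurable_const (by fun_prop))
  have hcount := sum_sum_lintegral_le_of_measure_lt_le hem
    (fun k l z => Set.indicator_le_self' (by simp) z) hfst' hsnd' (t := 0)
    (by
      refine le_trans (measure_mono fun θ hθ => ?_) hS
      simp only [ENNReal.coe_zero, Set.mem_ofPred_eq, pos_iff_ne_zero, ne_eq,
        Finset.sum_eq_zero_iff, not_forall] at hθ
      obtain ⟨q, -, hq⟩ := hθ
      have hq' : (θ.1 q.1, θ.2 q.2) ∈ {z | L < g q.1 q.2 z} := Set.mem_of_indicator_ne_zero hq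
      exact lt_of_lt_of_le hq' (hle q.1 q.2 θ))
  have key := sum_lintegral_le_two_mul_lintegral
    (P := (Measure.pi fun _ : ι => μ).prod (Measure.pi fun _ : κ => μ)) (J := ι × κ)
    (a := fun q θ => {z | L < g q.1 q.2 z}.indicator (g q.1 q.2) (θ.1 q.1, θ.2 q.2)) (S := S)
    (e := fun q θ => e q.1 q.2 (θ.1 q.1, θ.2 q.2))
    (fun q => (ham q.1 q.2).comp (by fun_prop))
    (fun q θ => (Set.indicator_le_self _ _ _).trans (hle q.1 q.2 θ))
    (fun q => (hem q.1 q.2).comp (by fun_prop))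
    (fun q θ hθ => by
      simp only [he]
      rw [Set.indicator_of_mem (Set.mem_of_indicator_ne_zero hθ)]; rfl)
    (fun q => by
      rw [lintegral_pi_prod_eval q.1 q.2 (ham q.1 q.2)]
      refine (sum_erase_lintegral_mul_le (ham q.1 q.2) hem hfst' hsnd' q.1 q.2).trans ?_
      gcongr
      calc _ ≤ ((2 * 0 + (1 + 2 * (1 / 8)) / 8 : ℝ≥0) : ℝ≥0∞) + 2 * (1 / 8 : ℝ≥0) := by
            gcongr
        _ ≤ ((1 / 2 : ℝ≥0) : ℝ≥0∞) := by
            rw [show (2 : ℝ≥0∞) = ((2 : ℝ≥0) : ℝ≥0∞) by simp, ← ENNReal.coe_mul, ← ENNReal.coe_add,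
              ENNReal.coe_le_coe, ← NNReal.coe_le_coe]
            norm_num
        _ = 1 / 2 := by rw [ENNReal.coe_div (by norm_num)]; simp)
  rw [Fintype.sum_prod_type] at key
  refine le_trans (le_of_eq ?_) key
  exact Finset.sum_congr rfl fun k _ => Finset.sum_congr rfl fun l _ =>
    (lintegral_pi_prod_eval k l (ham k l)).symm

/-- The two-variable form of `sum_lintegral_indicator_le_rpow_le`, under a boundedness hypothesis on
the sections. -/
theorem sum_sum_lintegral_indicator_le_rpow_le {g : ι → κ → Ω × Ω → ℝ≥0∞}
    (hg : ∀ k l, Measurable (g k l)) {p : ℝ} (hp : 1 ≤ p) {L : ℝ≥0∞} (hL0 : L ≠ 0) (hLT : L ≠ ⊤)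
    (hS : (Measure.pi fun _ : ι => μ).prod (Measure.pi fun _ : κ => μ)
      {θ | L < (∑ k, ∑ l, g k l (θ.1 k, θ.2 l) ^ p) ^ (1 / p)} ≤ 1 / 128)
    (hfst : ∀ k ξ, ∑ l, ∫⁻ υ, ({υ | g k l (ξ, υ) ≤ L}.indicator (fun υ => g k l (ξ, υ)) υ) ^ p ∂μ
      ≤ (17 / 8 : ℝ≥0) * L ^ p)
    (hsnd : ∀ l υ, ∑ k, ∫⁻ ξ, ({ξ | g k l (ξ, υ) ≤ L}.indicator (fun ξ => g k l (ξ, υ)) ξ) ^ p ∂μ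
      ≤ (17 / 8 : ℝ≥0) * L ^ p) :
    ∑ k, ∑ l, ∫⁻ z, ({z | g k l z ≤ L}.indicator (g k l) z) ^ p ∂(μ.prod μ) ≤ 3 * L ^ p := by
  have hp0 : 0 < p := zero_lt_one.trans_le hp
  have hL0p : L ^ p ≠ 0 := by simp [hL0, hLT]
  have hLTp : L ^ p ≠ ⊤ := by simp [hL0, hLT]
  have ham : ∀ k l, Measurable ({z | g k l z ≤ L}.indicator (g k l)) := fun k l =>
    (hg k l).indicator (measurableSet_le (hg k l) measurable_const)
  have hdiv : ∀ x : ℝ≥0∞, (x / L) ^ p = x ^ p * (L ^ p)⁻¹ := fun x => by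
    rw [ENNReal.div_rpow_of_nonneg _ _ hp0.le, div_eq_mul_inv]
  have key := sum_sum_lintegral_le_of_measure_lt_le (μ := μ) (δ := 17 / 8) (t := 1)
    (w := fun k l z => ({z | g k l z ≤ L}.indicator (g k l) z / L) ^ p)
    (fun k l => ((ham k l).div_const L).pow_const p)
    (fun k l z => indicator_le_div_rpow_le_one hp0 z)
    (fun k ξ => by
      simp_rw [hdiv]
      calc _ = (∑ l, ∫⁻ υ, ({υ | g k l (ξ, υ) ≤ L}.indicator (fun υ => g k l (ξ, υ)) υ) ^ p ∂μ)
            * (L ^ p)⁻¹ := by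
            rw [Finset.sum_mul]
            refine Finset.sum_congr rfl fun l _ => ?_
            rw [lintegral_mul_const]
            · rfl
            · exact ((ham k l).comp measurable_prodMk_left).pow_const p
        _ ≤ _ := by
            rw [← div_eq_mul_inv, ENNReal.div_le_iff hL0p hLTp]
            exact hfst k ξ)
    (fun l υ => by
      simp_rw [hdiv]
      calc _ = (∑ k, ∫⁻ ξ, ({ξ | g k l (ξ, υ) ≤ L}.indicator (fun ξ => g k l (ξ, υ)) ξ) ^ p ∂μ)
            * (L ^ p)⁻¹ := by
            rw [Finset.sum_mul]
            refine Finset.sum_congr rfl fun k _ => ?_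
            rw [lintegral_mul_const]
            · rfl
            · exact ((ham k l).comp measurable_prodMk_right).pow_const p
        _ ≤ _ := by
            rw [← div_eq_mul_inv, ENNReal.div_le_iff hL0p hLTp]
            exact hsnd l υ)
    (by
      refine le_trans (measure_mono fun θ hθ => ?_) hS
      have := lt_rpow_of_one_lt_sum_div_rpow
        (s := fun q : ι × κ => g q.1 q.2 (θ.1 q.1, θ.2 q.2))
        (fun q => Set.indicator_le_self _ _ _) hp0 hL0 hLT (by simpa using hθ)
      rwa [Fintype.sum_prod_type] at this)
  simp_rw [hdiv] at key
  have e : ∑ k, ∑ l, ∫⁻ z, ({z | g k l z ≤ L}.indicator (g k l) z) ^ p * (L ^ p)⁻¹ ∂(μ.prod μ)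
      = (∑ k, ∑ l, ∫⁻ z, ({z | g k l z ≤ L}.indicator (g k l) z) ^ p ∂(μ.prod μ)) / L ^ p := by
    simp_rw [div_eq_mul_inv, Finset.sum_mul]
    refine Finset.sum_congr rfl fun k _ => Finset.sum_congr rfl fun l _ => ?_
    rw [lintegral_mul_const _ ((ham k l).pow_const p)]
  rw [e, ENNReal.div_le_iff hL0p hLTp] at key
  refine key.trans ?_
  gcongr
  rw [show (3 : ℝ≥0∞) = ((3 : ℝ≥0) : ℝ≥0∞) by simp, ENNReal.coe_le_coe, ← NNReal.coe_le_coe]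
  norm_num

end TwoVariables

/-! ### The decomposition -/

section Decomposition

variable {Ω : Type*} [MeasurableSpace Ω] {μ : Measure Ω} [IsProbabilityMeasure μ]
  {ι κ : Type*} [Fintype ι] [Fintype κ]

/-- `E (∑ i j, g i j (x i, y j) ^ p) ^ (1 / p)` for independent `x i`, `y j` of law `μ`, as one
integral over the product space, for a family with values in `[0, ∞]`. -/
noncomputable def decoupledMean (μ : Measure Ω) (p : ℝ) (g : ι → κ → Ω × Ω → ℝ≥0∞) : ℝ≥0∞ :=
  ∫⁻ θ : (ι → Ω) × (κ → Ω), (∑ i, ∑ j, g i j (θ.1 i, θ.2 j) ^ p) ^ (1 / p)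
    ∂((Measure.pi fun _ => μ).prod (Measure.pi fun _ => μ))

/-- `E (∑ j, g i j (ξ, y j) ^ p) ^ (1 / p)`: the expectation over `y` of the `ℓᵖ` norm of row `i`,
with the first variable fixed at `ξ`. -/
noncomputable def rowMean (μ : Measure Ω) (p : ℝ) (g : ι → κ → Ω × Ω → ℝ≥0∞) (i : ι) (ξ : Ω) :
    ℝ≥0∞ :=
  ∫⁻ y : κ → Ω, (∑ j, g i j (ξ, y j) ^ p) ^ (1 / p) ∂(Measure.pi fun _ => μ)

/-- The family with the roles of rows and columns, and of the two variables, exchanged.Its row means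
are the column means of `g`. -/
def swapFamily (g : ι → κ → Ω × Ω → ℝ≥0∞) : κ → ι → Ω × Ω → ℝ≥0∞ :=
  fun j i z => g i j z.swap

omit [Fintype ι] in
theorem measurable_rowMean (p : ℝ) {g : ι → κ → Ω × Ω → ℝ≥0∞} (hg : ∀ i j, Measurable (g i j))
    (i : ι) : Measurable (rowMean μ p g i) :=
  Measurable.lintegral_prod_right' (ν := Measure.pi fun _ : κ => μ)
    (f := fun w : Ω × (κ → Ω) => (∑ j, g i j (w.1, w.2 j) ^ p) ^ (1 / p)) (by fun_prop)

omit [Fintype ι] [Fintype κ] in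
theorem measurable_swapFamily {g : ι → κ → Ω × Ω → ℝ≥0∞} (hg : ∀ i j, Measurable (g i j))
    (j : κ) (i : ι) : Measurable (swapFamily g j i) :=
  (hg i j).comp measurable_swap

theorem decoupledMean_swapFamily (p : ℝ) {g : ι → κ → Ω × Ω → ℝ≥0∞}
    (hg : ∀ i j, Measurable (g i j)) :
    decoupledMean μ p (swapFamily g) = decoupledMean μ p g := by
  have h := (Measure.measurePreserving_swap (μ := Measure.pi fun _ : κ => μ)
    (ν := Measure.pi fun _ : ι => μ)).lintegral_comp
    (f := fun θ : (ι → Ω) × (κ → Ω) => (∑ i, ∑ j, g i j (θ.1 i, θ.2 j) ^ p) ^ (1 / p))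
    (by fun_prop)
  rw [decoupledMean, decoupledMean, ← h]
  refine lintegral_congr fun θ => ?_
  rw [Finset.sum_comm]
  rfl

theorem le_sum_rpow_rpow {J : Type*} [Fintype J] {p : ℝ} (hp : 0 < p) (s : J → ℝ≥0∞) (k : J) :
    s k ≤ (∑ k, s k ^ p) ^ (1 / p) := by
  rw [one_div, ENNReal.le_rpow_inv_iff hp]
  exact Finset.single_le_sum (f := fun k => s k ^ p) (fun _ _ => zero_le) (Finset.mem_univ k)

theorem mul_rpow_rpow_one_div_le {p : ℝ} (hp : 1 ≤ p) {c : ℝ≥0∞} (hc : 1 ≤ c) (L : ℝ≥0∞) :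
    (c * L ^ p) ^ (1 / p) ≤ c * L := by
  have hp0 : 0 < p := zero_lt_one.trans_le hp
  rw [ENNReal.mul_rpow_of_nonneg _ _ (by positivity), ← ENNReal.rpow_mul,
    mul_one_div_cancel hp0.ne', ENNReal.rpow_one]
  gcongr
  calc c ^ (1 / p) ≤ c ^ (1 : ℝ) :=
        ENNReal.rpow_le_rpow_of_exponent_le hc ((div_le_one hp0).2 hp)
    _ = c := ENNReal.rpow_one c

variable {p : ℝ} {g : ι → κ → Ω × Ω → ℝ≥0∞}

/-- The maximum of the row means over the sampled points is at most the mean over `y` of the full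
`ℓᵖ` norm, so the large row means are summable. -/
theorem sum_lintegral_rowMean_indicator_le (hp : 1 ≤ p) (hg : ∀ i j, Measurable (g i j))
    (hN : decoupledMean μ p g ≤ 1) :
    ∑ i, ∫⁻ ξ, {ξ | 128 < rowMean μ p g i ξ}.indicator (rowMean μ p g i) ξ ∂μ ≤ 2 := by
  have hSm : Measurable fun θ : (ι → Ω) × (κ → Ω) =>
    (∑ i, ∑ j, g i j (θ.1 i, θ.2 j) ^ p) ^ (1 / p) := by fun_prop
  have := sum_lintegral_indicator_lt_le (μ := μ) (measurable_rowMean (μ := μ) p hg)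
    (S := fun x => ∫⁻ y : κ → Ω, (∑ i, ∑ j, g i j (x i, y j) ^ p) ^ (1 / p)
      ∂(Measure.pi fun _ => μ)) (v := 1) hSm.lintegral_prod_right'
    (fun x i => by
      refine lintegral_mono fun y => ENNReal.rpow_le_rpow ?_ (by positivity)
      exact Finset.single_le_sum (f := fun i => ∑ j, g i j (x i, y j) ^ p)
        (fun _ _ => zero_le) (Finset.mem_univ i))
    one_ne_zero (by rwa [decoupledMean, lintegral_prod _ hSm.aemeasurable] at hN)
  simpa using this

/-- In the rows with large mean, the part above `128` times the row mean lies in `L¹`: apply the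
one-variable estimate in each row, and sum the row means. -/
theorem sum_sum_lintegral_rowMean_lt_le (hp : 1 ≤ p) (hg : ∀ i j, Measurable (g i j))
    (hN : decoupledMean μ p g ≤ 1) :
    ∑ i, ∑ j, ∫⁻ z, {z | 128 < rowMean μ p g i z.1 ∧ 128 * rowMean μ p g i z.1 < g i j z}.indicator
      (g i j) z ∂(μ.prod μ) ≤ 4 := by
  have hp0 : 0 < p := zero_lt_one.trans_le hp
  have hu := measurable_rowMean (μ := μ) p hg
  have hset : ∀ i j, MeasurableSet
      {z : Ω × Ω | 128 < rowMean μ p g i z.1 ∧ 128 * rowMean μ p g i z.1 < g i j z} := fun i j =>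
    (measurableSet_lt measurable_const ((hu i).comp measurable_fst)).inter
      (measurableSet_lt (((hu i).comp measurable_fst).const_mul 128) (hg i j))
  have hind := fun i j => (hg i j).indicator (hset i j)
  calc _ = ∑ i, ∫⁻ ξ, ∑ j, ∫⁻ υ, {z : Ω × Ω | 128 < rowMean μ p g i z.1
          ∧ 128 * rowMean μ p g i z.1 < g i j z}.indicator (g i j) (ξ, υ) ∂μ ∂μ := by
        refine Finset.sum_congr rfl fun i _ => ?_
        rw [lintegral_finsetSum _ fun j _ => (hind i j).lintegral_prod_right']
        exact Finset.sum_congr rfl fun j _ => lintegral_prod _ (hind i j).aemeasurable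
    _ ≤ ∑ i, ∫⁻ ξ, 2 * {ξ | 128 < rowMean μ p g i ξ}.indicator (rowMean μ p g i) ξ ∂μ := by
        refine Finset.sum_le_sum fun i _ => lintegral_mono fun ξ => ?_
        by_cases h : 128 < rowMean μ p g i ξ
        · rw [Set.indicator_of_mem (by exact h)]
          refine le_trans (Finset.sum_le_sum fun j _ => lintegral_mono fun υ => ?_)
            (sum_lintegral_indicator_lt_le (μ := μ) (h := fun j υ => g i j (ξ, υ))
              (S := fun y => (∑ j, g i j (ξ, y j) ^ p) ^ (1 / p)) (v := rowMean μ p g i ξ)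
              (fun j => by fun_prop) (by fun_prop)
              (fun y j => le_sum_rpow_rpow hp0 (fun j => g i j (ξ, y j)) j)
              (pos_iff_ne_zero.1 (zero_le.trans_lt h)) le_rfl)
          refine Set.indicator_apply_le' (fun hz => ?_) (fun _ => zero_le)
          rw [Set.indicator_of_mem (by exact hz.2)]
        · rw [Set.indicator_of_notMem (by exact h), mul_zero]
          refine le_of_eq (Finset.sum_eq_zero fun j _ => ?_)
          simp [Set.indicator, h]
    _ = 2 * ∑ i, ∫⁻ ξ, {ξ | 128 < rowMean μ p g i ξ}.indicator (rowMean μ p g i) ξ ∂μ := by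
        rw [Finset.mul_sum]
        refine Finset.sum_congr rfl fun i _ => lintegral_const_mul _ ?_
        exact (hu i).indicator (measurableSet_lt measurable_const (hu i))
    _ ≤ 2 * 2 := by gcongr; exact sum_lintegral_rowMean_indicator_le hp hg hN
    _ = 4 := by norm_num

/-- In the rows with large mean, the part below `128` times the row mean lies in `L¹(Lᵖ)`. -/
theorem sum_lintegral_rowMean_le_rpow_le (hp : 1 ≤ p) (hg : ∀ i j, Measurable (g i j))
    (hN : decoupledMean μ p g ≤ 1) :
    ∑ i, ∫⁻ ξ, (∑ j, ∫⁻ υ, ({z : Ω × Ω | 128 < rowMean μ p g i z.1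
      ∧ g i j z ≤ 128 * rowMean μ p g i z.1}.indicator (g i j) (ξ, υ)) ^ p ∂μ) ^ (1 / p) ∂μ
      ≤ 768 := by
  have hp0 : 0 < p := zero_lt_one.trans_le hp
  have hu := measurable_rowMean (μ := μ) p hg
  calc _ ≤ ∑ i, ∫⁻ ξ, 384 * {ξ | 128 < rowMean μ p g i ξ}.indicator (rowMean μ p g i) ξ ∂μ := by
        refine Finset.sum_le_sum fun i _ => lintegral_mono fun ξ => ?_
        by_cases h : 128 < rowMean μ p g i ξ
        · rw [Set.indicator_of_mem (by exact h)]
          have h1 := sum_lintegral_indicator_le_rpow_le (μ := μ) (h := fun j υ => g i j (ξ, υ))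
            (fun j => by fun_prop) hp (v := rowMean μ p g i ξ)
            (pos_iff_ne_zero.1 (zero_le.trans_lt h)) le_rfl
          have h2 : ∑ j, ∫⁻ υ, ({z : Ω × Ω | 128 < rowMean μ p g i z.1
              ∧ g i j z ≤ 128 * rowMean μ p g i z.1}.indicator (g i j) (ξ, υ)) ^ p ∂μ
              ≤ 3 * (128 * rowMean μ p g i ξ) ^ p := by
            refine le_trans (le_trans (Finset.sum_le_sum fun j _ => lintegral_mono fun υ => ?_) h1)
              ?_
            · refine ENNReal.rpow_le_rpow ?_ hp0.le
              refine Set.indicator_apply_le' (fun hz => ?_) (fun _ => zero_le)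
              rw [Set.indicator_of_mem (by exact hz.2)]
            · gcongr
              rw [show (3 : ℝ≥0∞) = ((3 : ℝ≥0) : ℝ≥0∞) by simp, ENNReal.coe_le_coe,
                ← NNReal.coe_le_coe]
              norm_num
          refine (ENNReal.rpow_le_rpow h2 (by positivity)).trans
            ((mul_rpow_rpow_one_div_le hp (by norm_num) _).trans (le_of_eq ?_))
          rw [← mul_assoc]
          norm_num
        · rw [Set.indicator_of_notMem (by exact h), mul_zero]
          simp [Set.indicator, h, hp0]
    _ = 384 * ∑ i, ∫⁻ ξ, {ξ | 128 < rowMean μ p g i ξ}.indicator (rowMean μ p g i) ξ ∂μ := by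
        rw [Finset.mul_sum]
        refine Finset.sum_congr rfl fun i _ => lintegral_const_mul _ ?_
        exact (hu i).indicator (measurableSet_lt measurable_const (hu i))
    _ ≤ 384 * 2 := by gcongr; exact sum_lintegral_rowMean_indicator_le hp hg hN
    _ = 768 := by norm_num

/-- The part of `g i j` where both the row mean and the column mean are at most `128`. -/
noncomputable def smallMeanPart (μ : Measure Ω) (p : ℝ) (g : ι → κ → Ω × Ω → ℝ≥0∞) (i : ι) (j : κ) :
    Ω × Ω → ℝ≥0∞ :=
  {z | rowMean μ p g i z.1 ≤ 128 ∧ rowMean μ p (swapFamily g) j z.2 ≤ 128}.indicator (g i j)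

theorem measurable_smallMeanPart (hg : ∀ i j, Measurable (g i j)) (i : ι) (j : κ) :
    Measurable (smallMeanPart μ p g i j) :=
  (hg i j).indicator
    ((measurableSet_le ((measurable_rowMean p hg i).comp measurable_fst) measurable_const).inter
      (measurableSet_le ((measurable_rowMean p (measurable_swapFamily hg) j).comp measurable_snd)
        measurable_const))

omit [IsProbabilityMeasure μ] in
theorem smallMeanPart_le (i : ι) (j : κ) (z : Ω × Ω) : smallMeanPart μ p g i j z ≤ g i j z :=
  Set.indicator_le_self _ _ _

omit [IsProbabilityMeasure μ] in
theorem measure_lt_sum_rpow_le (hg : ∀ i j, Measurable (g i j))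
    (hN : decoupledMean μ p g ≤ 1) :
    (Measure.pi fun _ : ι => μ).prod (Measure.pi fun _ : κ => μ)
      {θ | 128 * 128 < (∑ i, ∑ j, g i j (θ.1 i, θ.2 j) ^ p) ^ (1 / p)} ≤ 1 / 128 := by
  simpa using measure_lt_le_of_lintegral_le (by fun_prop) (v := 128) (by norm_num)
    (hN.trans (by simp))

/-- Where row and column means are at most `128`, the one-variable estimates bound the sections at
level `128 * 128`, so that the two-variable estimates apply at that level. -/
theorem sum_sum_lintegral_smallMeanPart_lt_le (hp : 1 ≤ p) (hg : ∀ i j, Measurable (g i j))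
    (hN : decoupledMean μ p g ≤ 1) :
    ∑ i, ∑ j, ∫⁻ z, {z | 128 * 128 < smallMeanPart μ p g i j z}.indicator
      (smallMeanPart μ p g i j) z ∂(μ.prod μ) ≤ 2 := by
  have hp0 : 0 < p := zero_lt_one.trans_le hp
  refine (sum_sum_lintegral_indicator_lt_le (measurable_smallMeanPart hg)
    (S := fun θ => (∑ i, ∑ j, g i j (θ.1 i, θ.2 j) ^ p) ^ (1 / p)) (fun i j θ => ?_)
    (measure_lt_sum_rpow_le hg hN) (fun i ξ => ?_) (fun j υ => ?_)).trans ?_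
  · refine (smallMeanPart_le i j _).trans ?_
    have := le_sum_rpow_rpow hp0 (fun q : ι × κ => g q.1 q.2 (θ.1 q.1, θ.2 q.2)) (i, j)
    rwa [Fintype.sum_prod_type] at this
  · by_cases h : rowMean μ p g i ξ ≤ 128
    · have := sum_measure_lt_le (μ := μ) (h := fun j υ => g i j (ξ, υ))
        (S := fun y => (∑ j, g i j (ξ, y j) ^ p) ^ (1 / p)) (v := 128)
        (fun j => by fun_prop) (by fun_prop)
        (fun y j => le_sum_rpow_rpow hp0 (fun j => g i j (ξ, y j)) j) (by norm_num) h
      refine le_trans (Finset.sum_le_sum fun j _ => measure_mono fun υ hυ => ?_) this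
      exact lt_of_lt_of_le hυ (smallMeanPart_le i j _)
    · simp [smallMeanPart, Set.indicator, h]
  · by_cases h : rowMean μ p (swapFamily g) j υ ≤ 128
    · have := sum_measure_lt_le (μ := μ) (h := fun i ξ => g i j (ξ, υ))
        (S := fun x => (∑ i, g i j (x i, υ) ^ p) ^ (1 / p)) (v := 128)
        (fun i => by fun_prop) (by fun_prop)
        (fun x i => le_sum_rpow_rpow hp0 (fun i => g i j (x i, υ)) i) (by norm_num) h
      refine le_trans (Finset.sum_le_sum fun i _ => measure_mono fun ξ hξ => ?_) this
      exact lt_of_lt_of_le hξ (smallMeanPart_le i j _)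
    · simp [smallMeanPart, Set.indicator, h]
  · calc _ ≤ (2 * 1 : ℝ≥0∞) := mul_le_mul_right hN 2
      _ = 2 := mul_one 2

omit [IsProbabilityMeasure μ] in
theorem indicator_le_smallMeanPart_le (i : ι) (j : κ) (L : ℝ≥0∞) (z : Ω × Ω) :
    {z | smallMeanPart μ p g i j z ≤ L}.indicator (smallMeanPart μ p g i j) z
      ≤ {z | g i j z ≤ L}.indicator (g i j) z := by
  by_cases h : rowMean μ p g i z.1 ≤ 128 ∧ rowMean μ p (swapFamily g) j z.2 ≤ 128
  · have e : smallMeanPart μ p g i j z = g i j z := Set.indicator_of_mem (by exact h) _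
    refine Set.indicator_apply_le' (fun hz => ?_) (fun _ => zero_le)
    rw [Set.mem_ofPred_eq, e] at hz
    rw [e, Set.indicator_of_mem (by exact hz)]
  · have e : smallMeanPart μ p g i j z = 0 := Set.indicator_of_notMem (by exact h) _
    simp [Set.indicator, e]

theorem sum_sum_lintegral_smallMeanPart_le_rpow_le (hp : 1 ≤ p) (hg : ∀ i j, Measurable (g i j))
    (hN : decoupledMean μ p g ≤ 1) :
    ∑ i, ∑ j, ∫⁻ z, ({z | smallMeanPart μ p g i j z ≤ 128 * 128}.indicator
      (smallMeanPart μ p g i j) z) ^ p ∂(μ.prod μ) ≤ 3 * (128 * 128) ^ p := by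
  have hp0 : 0 < p := zero_lt_one.trans_le hp
  refine sum_sum_lintegral_indicator_le_rpow_le (measurable_smallMeanPart hg) hp (by simp)
    (by simp [ENNReal.mul_eq_top]) ?_ (fun i ξ => ?_) (fun j υ => ?_)
  · refine le_trans (measure_mono fun θ hθ => ?_) (measure_lt_sum_rpow_le hg hN)
    refine lt_of_lt_of_le (b := (∑ i, ∑ j, smallMeanPart μ p g i j (θ.1 i, θ.2 j) ^ p) ^ (1 / p))
      hθ ?_
    gcongr with i _ j _
    exact smallMeanPart_le i j _
  · by_cases h : rowMean μ p g i ξ ≤ 128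
    · have := sum_lintegral_indicator_le_rpow_le (μ := μ) (h := fun j υ => g i j (ξ, υ))
        (fun j => by fun_prop) hp (v := 128) (by simp) h
      refine le_trans (Finset.sum_le_sum fun j _ => lintegral_mono fun υ => ?_) this
      exact ENNReal.rpow_le_rpow (indicator_le_smallMeanPart_le i j _ (ξ, υ)) hp0.le
    · simp [smallMeanPart, Set.indicator, h, hp0]
  · by_cases h : rowMean μ p (swapFamily g) j υ ≤ 128
    · have := sum_lintegral_indicator_le_rpow_le (μ := μ) (h := fun i ξ => g i j (ξ, υ))
        (fun i => by fun_prop) hp (v := 128) (by simp) h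
      refine le_trans (Finset.sum_le_sum fun i _ => lintegral_mono fun ξ => ?_) this
      exact ENNReal.rpow_le_rpow (indicator_le_smallMeanPart_le i j _ (ξ, υ)) hp0.le
    · simp [smallMeanPart, Set.indicator, h, hp0]

open Classical in
/-- The piece (`0, 1, 2, 3` for `a, b, c, d`) to which a point belongs. A row with large mean is
split at a level proportional to its mean, the rest of a column with large mean likewise, and what
is left is split at a constant level. -/
noncomputable def pieceLabel (μ : Measure Ω) (p : ℝ) (g : ι → κ → Ω × Ω → ℝ≥0∞) (i : ι) (j : κ)
    (z : Ω × Ω) : Fin 4 :=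
  if 128 < rowMean μ p g i z.1 then
    if 128 * rowMean μ p g i z.1 < g i j z then 0 else 2
  else if 128 < rowMean μ p (swapFamily g) j z.2 then
    if 128 * rowMean μ p (swapFamily g) j z.2 < g i j z then 0 else 3
  else if 128 * 128 < g i j z then 0 else 1

theorem measurable_pieceLabel (hg : ∀ i j, Measurable (g i j)) (i : ι) (j : κ) :
    Measurable (pieceLabel μ p g i j) := by
  have hu : Measurable fun z : Ω × Ω => rowMean μ p g i z.1 :=
    (measurable_rowMean p hg i).comp measurable_fst
  have hv : Measurable fun z : Ω × Ω => rowMean μ p (swapFamily g) j z.2 :=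
    (measurable_rowMean p (measurable_swapFamily hg) j).comp measurable_snd
  refine Measurable.ite (measurableSet_lt measurable_const hu) ?_
    (Measurable.ite (measurableSet_lt measurable_const hv) ?_ ?_)
  · exact Measurable.ite (measurableSet_lt (hu.const_mul 128) (hg i j)) measurable_const
      measurable_const
  · exact Measurable.ite (measurableSet_lt (hv.const_mul 128) (hg i j)) measurable_const
      measurable_const
  · exact Measurable.ite (measurableSet_lt measurable_const (hg i j)) measurable_const
      measurable_const

theorem sum_sum_lintegral_pieceLabel_zero_le (hp : 1 ≤ p) (hg : ∀ i j, Measurable (g i j))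
    (hN : decoupledMean μ p g ≤ 1) :
    ∑ i, ∑ j, ∫⁻ z, {z | pieceLabel μ p g i j z = 0}.indicator (g i j) z ∂(μ.prod μ) ≤ 10 := by
  have h1 := sum_sum_lintegral_rowMean_lt_le hp hg hN
  have h2 := sum_sum_lintegral_rowMean_lt_le hp (measurable_swapFamily hg)
    ((decoupledMean_swapFamily p hg).trans_le hN)
  have h3 := sum_sum_lintegral_smallMeanPart_lt_le hp hg hN
  have hu := measurable_rowMean (μ := μ) p hg
  have hv := measurable_rowMean (μ := μ) p (measurable_swapFamily hg)
  set s1 : ι → κ → Ω × Ω → ℝ≥0∞ := fun i j => {z | 128 < rowMean μ p g i z.1 ∧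
    128 * rowMean μ p g i z.1 < g i j z}.indicator (g i j) with hs1
  set s2 : ι → κ → Ω × Ω → ℝ≥0∞ := fun i j z => {z | 128 < rowMean μ p (swapFamily g) j z.1 ∧
    128 * rowMean μ p (swapFamily g) j z.1 < swapFamily g j i z}.indicator (swapFamily g j i) z.swap
    with hs2
  set s3 : ι → κ → Ω × Ω → ℝ≥0∞ := fun i j => {z | 128 * 128 < smallMeanPart μ p g i j z}.indicator
      (smallMeanPart μ p g i j) with hs3
  have hm1 : ∀ i j, Measurable (s1 i j) := fun i j => (hg i j).indicator
    ((measurableSet_lt measurable_const ((hu i).comp measurable_fst)).inter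
      (measurableSet_lt (((hu i).comp measurable_fst).const_mul 128) (hg i j)))
  have hm2' : ∀ i j, Measurable ({z : Ω × Ω | 128 < rowMean μ p (swapFamily g) j z.1 ∧
      128 * rowMean μ p (swapFamily g) j z.1 < swapFamily g j i z}.indicator (swapFamily g j i)) :=
    fun i j => (measurable_swapFamily hg j i).indicator
    ((measurableSet_lt measurable_const ((hv j).comp measurable_fst)).inter
      (measurableSet_lt (((hv j).comp measurable_fst).const_mul 128) (measurable_swapFamily hg j i)))
  have h2' : ∑ i, ∑ j, ∫⁻ z, s2 i j z ∂(μ.prod μ) ≤ 4 := by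
    rw [Finset.sum_comm]
    refine le_trans (le_of_eq ?_) h2
    exact Finset.sum_congr rfl fun j _ => Finset.sum_congr rfl fun i _ =>
      Measure.measurePreserving_swap.lintegral_comp (hm2' i j)
  -- the three branches of `pieceLabel` that give the label `0`
  have hle : ∀ i j z, {z | pieceLabel μ p g i j z = 0}.indicator (g i j) z
      ≤ s1 i j z + (s2 i j z + s3 i j z) := by
    intro i j z
    refine Set.indicator_apply_le' (fun hz => ?_) (fun _ => zero_le)
    simp only [Set.mem_ofPred_eq, pieceLabel] at hz
    split_ifs at hz with k1 k2 k3 k4 k5 <;> try (simp at hz; done)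
    · have e : s1 i j z = g i j z := Set.indicator_of_mem (by exact ⟨k1, k2⟩) _
      rw [e]
      exact le_self_add
    · have e : s2 i j z = g i j z := Set.indicator_of_mem (by exact ⟨k3, k4⟩) _
      rw [e]
      exact le_add_left le_self_add
    · have e' : smallMeanPart μ p g i j z = g i j z :=
        Set.indicator_of_mem (by exact ⟨not_lt.1 k1, not_lt.1 k3⟩) _
      have e : s3 i j z = g i j z :=
        (Set.indicator_of_mem (by rwa [Set.mem_ofPred_eq, e']) _).trans e'
      rw [e]
      exact le_add_left le_add_self
  have hm2 : ∀ i j, Measurable (s2 i j) := fun i j => (hm2' i j).comp measurable_swap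
  calc _ ≤ ∑ i, ∑ j, ∫⁻ z, s1 i j z + (s2 i j z + s3 i j z) ∂(μ.prod μ) :=
        Finset.sum_le_sum fun i _ => Finset.sum_le_sum fun j _ => lintegral_mono (hle i j)
    _ = ∑ i, ∑ j, ∫⁻ z, s1 i j z ∂(μ.prod μ) + (∑ i, ∑ j, ∫⁻ z, s2 i j z ∂(μ.prod μ)
        + ∑ i, ∑ j, ∫⁻ z, s3 i j z ∂(μ.prod μ)) := by
        simp_rw [← Finset.sum_add_distrib]
        refine Finset.sum_congr rfl fun i _ => Finset.sum_congr rfl fun j _ => ?_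
        rw [lintegral_add_left (hm1 i j), lintegral_add_left (hm2 i j)]
    _ ≤ 4 + (4 + 2) := by gcongr
    _ = 10 := by norm_num

theorem sum_sum_lintegral_pieceLabel_one_le (hp : 1 ≤ p) (hg : ∀ i j, Measurable (g i j))
    (hN : decoupledMean μ p g ≤ 1) :
    (∑ i, ∑ j, ∫⁻ z, ({z | pieceLabel μ p g i j z = 1}.indicator (g i j) z) ^ p ∂(μ.prod μ))
      ^ (1 / p) ≤ 49152 := by
  have hp0 : 0 < p := zero_lt_one.trans_le hp
  have h := sum_sum_lintegral_smallMeanPart_le_rpow_le hp hg hN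
  calc _ ≤ (3 * (128 * 128) ^ p : ℝ≥0∞) ^ (1 / p) := by
        refine ENNReal.rpow_le_rpow (le_trans ?_ h) (by positivity)
        refine Finset.sum_le_sum fun i _ => Finset.sum_le_sum fun j _ => lintegral_mono fun z =>
          ENNReal.rpow_le_rpow ?_ hp0.le
        refine Set.indicator_apply_le' (fun hz => ?_) (fun _ => zero_le)
        simp only [Set.mem_ofPred_eq, pieceLabel] at hz
        split_ifs at hz with k1 k2 k3 k4 k5 <;> try (simp at hz; done)
        have e' : smallMeanPart μ p g i j z = g i j z :=
          Set.indicator_of_mem (by exact ⟨not_lt.1 k1, not_lt.1 k3⟩) _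
        rw [Set.indicator_of_mem (by rw [Set.mem_ofPred_eq, e']; exact not_lt.1 k5), e']
    _ ≤ 3 * (128 * 128) := mul_rpow_rpow_one_div_le hp (by norm_num) _
    _ = 49152 := by norm_num

theorem sum_lintegral_pieceLabel_two_le (hp : 1 ≤ p) (hg : ∀ i j, Measurable (g i j))
    (hN : decoupledMean μ p g ≤ 1) :
    ∑ i, ∫⁻ ξ, (∑ j, ∫⁻ υ, ({z | pieceLabel μ p g i j z = 2}.indicator (g i j) (ξ, υ)) ^ p ∂μ)
      ^ (1 / p) ∂μ ≤ 768 := by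
  have hp0 : 0 < p := zero_lt_one.trans_le hp
  refine le_trans (Finset.sum_le_sum fun i _ => lintegral_mono fun ξ =>
    ENNReal.rpow_le_rpow (Finset.sum_le_sum fun j _ => lintegral_mono fun υ =>
      ENNReal.rpow_le_rpow ?_ hp0.le) (by positivity))
    (sum_lintegral_rowMean_le_rpow_le hp hg hN)
  refine Set.indicator_apply_le' (fun hz => ?_) (fun _ => zero_le)
  simp only [Set.mem_ofPred_eq, pieceLabel] at hz
  split_ifs at hz with k1 k2 k3 k4 k5 <;> try (simp at hz; done)
  rw [Set.indicator_of_mem (by exact ⟨k1, not_lt.1 k2⟩)]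

theorem sum_lintegral_pieceLabel_three_le (hp : 1 ≤ p) (hg : ∀ i j, Measurable (g i j))
    (hN : decoupledMean μ p g ≤ 1) :
    ∑ j, ∫⁻ υ, (∑ i, ∫⁻ ξ, ({z | pieceLabel μ p g i j z = 3}.indicator (g i j) (ξ, υ)) ^ p ∂μ)
      ^ (1 / p) ∂μ ≤ 768 := by
  have hp0 : 0 < p := zero_lt_one.trans_le hp
  refine le_trans (Finset.sum_le_sum fun j _ => lintegral_mono fun υ =>
    ENNReal.rpow_le_rpow (Finset.sum_le_sum fun i _ => lintegral_mono fun ξ =>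
      ENNReal.rpow_le_rpow ?_ hp0.le) (by positivity))
    (sum_lintegral_rowMean_le_rpow_le hp (measurable_swapFamily hg)
      ((decoupledMean_swapFamily p hg).trans_le hN))
  refine Set.indicator_apply_le' (fun hz => ?_) (fun _ => zero_le)
  simp only [Set.mem_ofPred_eq, pieceLabel] at hz
  split_ifs at hz with k1 k2 k3 k4 k5 <;> try (simp at hz; done)
  rw [Set.indicator_of_mem (by exact ⟨k3, not_lt.1 k4⟩)]
  exact le_rfl

end Decomposition

/-! ### The lower estimate -/

section LowerEstimate

theorem ENNReal.sum_rpow_le_sum_rpow {J : Type*} (s : Finset J) (t : J → ℝ≥0∞) {r : ℝ}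
    (hr0 : 0 < r) (hr1 : r ≤ 1) : (∑ k ∈ s, t k) ^ r ≤ ∑ k ∈ s, t k ^ r := by
  classical
  induction s using Finset.induction_on with
  | empty => simp [hr0]
  | insert k s hk ih =>
    rw [Finset.sum_insert hk, Finset.sum_insert hk]
    exact (ENNReal.rpow_add_le_add_rpow _ _ hr0.le hr1).trans (by gcongr)

theorem lintegral_rpow_one_div_le {Θ : Type*} [MeasurableSpace Θ] {P : Measure Θ}
    [IsProbabilityMeasure P] {F : Θ → ℝ≥0∞} (hF : Measurable F) {p : ℝ} (hp : 1 ≤ p) :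
    ∫⁻ θ, F θ ^ (1 / p) ∂P ≤ (∫⁻ θ, F θ ∂P) ^ (1 / p) := by
  have hp0 : p ≠ 0 := (zero_lt_one.trans_le hp).ne'
  have := eLpNorm'_le_eLpNorm'_of_exponent_le (f := fun θ => F θ ^ (1 / p)) zero_lt_one hp P
    (hF.pow_const _).aestronglyMeasurable
  simpa [eLpNorm', ← ENNReal.rpow_mul, hp0] using this

variable {Ω : Type*} [MeasurableSpace Ω] {μ : Measure Ω} [IsProbabilityMeasure μ]
  {ι κ : Type*} [Fintype ι] [Fintype κ] {p : ℝ} {g h : ι → κ → Ω × Ω → ℝ≥0∞}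

omit [IsProbabilityMeasure μ] in
theorem decoupledMean_add_le (hp : 1 ≤ p) (hg : ∀ i j, Measurable (g i j)) :
    decoupledMean μ p (fun i j z => g i j z + h i j z)
      ≤ decoupledMean μ p g + decoupledMean μ p h := by
  rw [decoupledMean, decoupledMean, decoupledMean, ← lintegral_add_left (by fun_prop)]
  refine lintegral_mono fun θ => ?_
  have := ENNReal.Lp_add_le (Finset.univ : Finset (ι × κ))
    (fun q => g q.1 q.2 (θ.1 q.1, θ.2 q.2)) (fun q => h q.1 q.2 (θ.1 q.1, θ.2 q.2)) hp
  simpa only [Fintype.sum_prod_type] using this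

theorem decoupledMean_le_L1 (hp : 1 ≤ p) (hg : ∀ i j, Measurable (g i j)) :
    decoupledMean μ p g ≤ ∑ i, ∑ j, ∫⁻ ξ, ∫⁻ υ, g i j (ξ, υ) ∂μ ∂μ := by
  have hp0 : 0 < p := zero_lt_one.trans_le hp
  have hr1 : 1 / p ≤ 1 := (div_le_one hp0).2 hp
  calc decoupledMean μ p g
      ≤ ∫⁻ θ : (ι → Ω) × (κ → Ω), ∑ i, ∑ j, g i j (θ.1 i, θ.2 j)
        ∂((Measure.pi fun _ => μ).prod (Measure.pi fun _ => μ)) := by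
        refine lintegral_mono fun θ => ?_
        have := ENNReal.sum_rpow_le_sum_rpow (Finset.univ : Finset (ι × κ))
          (fun q => g q.1 q.2 (θ.1 q.1, θ.2 q.2) ^ p) (one_div_pos.2 hp0) hr1
        simpa only [Fintype.sum_prod_type, ← ENNReal.rpow_mul, mul_one_div_cancel hp0.ne',
          ENNReal.rpow_one] using this
    _ = _ := by
        rw [lintegral_finsetSum _ (by fun_prop)]
        refine Finset.sum_congr rfl fun i _ => ?_
        rw [lintegral_finsetSum _ (by fun_prop)]
        refine Finset.sum_congr rfl fun j _ => ?_
        rw [lintegral_pi_prod_eval i j (hg i j), lintegral_prod _ (hg i j).aemeasurable]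

theorem decoupledMean_le_Lp (hp : 1 ≤ p) (hg : ∀ i j, Measurable (g i j)) :
    decoupledMean μ p g ≤ (∑ i, ∑ j, ∫⁻ ξ, ∫⁻ υ, g i j (ξ, υ) ^ p ∂μ ∂μ) ^ (1 / p) := by
  refine (lintegral_rpow_one_div_le (by fun_prop) hp).trans (le_of_eq ?_)
  congr 1
  rw [lintegral_finsetSum _ (by fun_prop)]
  refine Finset.sum_congr rfl fun i _ => ?_
  rw [lintegral_finsetSum _ (by fun_prop)]
  refine Finset.sum_congr rfl fun j _ => ?_
  rw [lintegral_pi_prod_eval i j ((hg i j).pow_const p),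
    lintegral_prod _ ((hg i j).pow_const p).aemeasurable]

/-- Use `ℓ¹ ⊆ ℓᵖ` in `i`, and Jensen's inequality in `y`. -/
theorem decoupledMean_le_L1Lp (hp : 1 ≤ p) (hg : ∀ i j, Measurable (g i j)) :
    decoupledMean μ p g ≤ ∑ i, ∫⁻ ξ, (∑ j, ∫⁻ υ, g i j (ξ, υ) ^ p ∂μ) ^ (1 / p) ∂μ := by
  have hp0 : 0 < p := zero_lt_one.trans_le hp
  have hr1 : 1 / p ≤ 1 := (div_le_one hp0).2 hp
  have hm : ∀ i, Measurable fun ξ => (∑ j, ∫⁻ υ, g i j (ξ, υ) ^ p ∂μ) ^ (1 / p) := fun i =>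
    (Finset.measurable_fun_sum _ fun j _ =>
      ((hg i j).pow_const p).lintegral_prod_right').pow_const _
  calc decoupledMean μ p g
      ≤ ∫⁻ θ : (ι → Ω) × (κ → Ω), ∑ i, (∑ j, g i j (θ.1 i, θ.2 j) ^ p) ^ (1 / p)
        ∂((Measure.pi fun _ => μ).prod (Measure.pi fun _ => μ)) :=
        lintegral_mono fun θ => ENNReal.sum_rpow_le_sum_rpow _ _ (one_div_pos.2 hp0) hr1
    _ = ∑ i, ∫⁻ x : ι → Ω, ∫⁻ y : κ → Ω, (∑ j, g i j (x i, y j) ^ p) ^ (1 / p)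
        ∂(Measure.pi fun _ => μ) ∂(Measure.pi fun _ => μ) := by
        rw [lintegral_finsetSum _ (by fun_prop)]
        exact Finset.sum_congr rfl fun i _ => lintegral_prod _ (by fun_prop)
    _ ≤ ∑ i, ∫⁻ x : ι → Ω, (∑ j, ∫⁻ υ, g i j (x i, υ) ^ p ∂μ) ^ (1 / p)
        ∂(Measure.pi fun _ => μ) := by
        refine Finset.sum_le_sum fun i _ => lintegral_mono fun x => ?_
        refine (lintegral_rpow_one_div_le (by fun_prop) hp).trans (le_of_eq ?_)
        congr 1
        rw [lintegral_finsetSum _ (by fun_prop)]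
        exact Finset.sum_congr rfl fun j _ =>
          lintegral_pi_eval (μ := μ) j (φ := fun υ => g i j (x i, υ) ^ p) (by fun_prop)
    _ = _ := Finset.sum_congr rfl fun i _ => lintegral_pi_eval i (hm i)

end LowerEstimate

/-! ### Passing between families and their absolute values -/

section Families

variable {Ω 𝕜 : Type*} [MeasurableSpace Ω] [RCLike 𝕜] {μ : Measure Ω} [IsProbabilityMeasure μ]
  {p : ℝ} {n : ℕ}

theorem decoupledNorm_congr {f f' : Fin n → Fin n → Ω × Ω → 𝕜}
    (h : ∀ i j, f i j =ᵐ[μ.prod μ] f' i j) : decoupledNorm μ p f = decoupledNorm μ p f' := by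
  have h1 : ∀ᵐ θ : (Fin n → Ω) × (Fin n → Ω)
      ∂((Measure.pi fun _ => μ).prod (Measure.pi fun _ => μ)),
      ∀ i j, f i j (θ.1 i, θ.2 j) = f' i j (θ.1 i, θ.2 j) :=
    ae_all_iff.2 fun i => ae_all_iff.2 fun j =>
      (measurePreserving_eval_prodMap μ i j).quasiMeasurePreserving.ae (h i j)
  refine lintegral_congr_ae ?_
  filter_upwards [Measure.ae_ae_of_ae_prod h1] with x hx
  refine lintegral_congr_ae ?_
  filter_upwards [hx] with y hy
  simp only [hy]

theorem decoupledNorm_eq_decoupledMean {f : Fin n → Fin n → Ω × Ω → 𝕜}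
    (hf : ∀ i j, StronglyMeasurable (f i j)) :
    decoupledNorm μ p f = decoupledMean μ p fun i j z => ‖f i j z‖ₑ := by
  have hg : ∀ i j, Measurable fun z => ‖f i j z‖ₑ := fun i j => (hf i j).enorm
  have hm : Measurable fun θ : (Fin n → Ω) × (Fin n → Ω) =>
      (∑ i, ∑ j, ‖f i j (θ.1 i, θ.2 j)‖ₑ ^ p) ^ (1 / p) :=
    (Finset.measurable_fun_sum _ fun i _ => Finset.measurable_fun_sum _ fun j _ =>
      ((hg i j).comp (by fun_prop)).pow_const p).pow_const _
  exact (lintegral_prod _ hm.aemeasurable).symm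

theorem ae_ae_swap_of_ae_prod {q : Ω × Ω → Prop} (h : ∀ᵐ z ∂(μ.prod μ), q z) :
    ∀ᵐ υ ∂μ, ∀ᵐ ξ ∂μ, q (ξ, υ) :=
  Measure.ae_ae_of_ae_prod (Measure.measurePreserving_swap.quasiMeasurePreserving.ae h)

theorem normL1_congr {a a' : Fin n → Fin n → Ω × Ω → 𝕜}
    (h : ∀ i j, a i j =ᵐ[μ.prod μ] a' i j) : normL1 μ a = normL1 μ a' := by
  refine Finset.sum_congr rfl fun i _ => Finset.sum_congr rfl fun j _ => lintegral_congr_ae ?_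
  filter_upwards [Measure.ae_ae_of_ae_prod (h i j)] with ξ hξ
  refine lintegral_congr_ae ?_
  filter_upwards [hξ] with υ hυ
  rw [hυ]

theorem normLp_congr {b b' : Fin n → Fin n → Ω × Ω → 𝕜}
    (h : ∀ i j, b i j =ᵐ[μ.prod μ] b' i j) : normLp μ p b = normLp μ p b' := by
  refine congrArg (· ^ (1 / p)) ?_
  refine Finset.sum_congr rfl fun i _ => Finset.sum_congr rfl fun j _ => lintegral_congr_ae ?_
  filter_upwards [Measure.ae_ae_of_ae_prod (h i j)] with ξ hξ
  refine lintegral_congr_ae ?_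
  filter_upwards [hξ] with υ hυ
  rw [hυ]

theorem normL1Lp_congr {c c' : Fin n → Fin n → Ω × Ω → 𝕜}
    (h : ∀ i j, c i j =ᵐ[μ.prod μ] c' i j) : normL1Lp μ p c = normL1Lp μ p c' := by
  refine Finset.sum_congr rfl fun i _ => lintegral_congr_ae ?_
  filter_upwards [ae_all_iff.2 fun j => Measure.ae_ae_of_ae_prod (h i j)] with ξ hξ
  refine congrArg (· ^ (1 / p)) (Finset.sum_congr rfl fun j _ => lintegral_congr_ae ?_)
  filter_upwards [hξ j] with υ hυ
  rw [hυ]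

theorem normL1LpSwap_congr {d d' : Fin n → Fin n → Ω × Ω → 𝕜}
    (h : ∀ i j, d i j =ᵐ[μ.prod μ] d' i j) : normL1LpSwap μ p d = normL1LpSwap μ p d' := by
  refine Finset.sum_congr rfl fun j _ => lintegral_congr_ae ?_
  filter_upwards [ae_all_iff.2 fun i => ae_ae_swap_of_ae_prod (h i j)] with υ hυ
  refine congrArg (· ^ (1 / p)) (Finset.sum_congr rfl fun i _ => lintegral_congr_ae ?_)
  filter_upwards [hυ i] with ξ hξ
  rw [hξ]

theorem decoupledNorm_le_of_isDecomposition (hp : 1 ≤ p) {f a b c d : Fin n → Fin n → Ω × Ω → 𝕜}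
    (h : IsDecomposition μ f a b c d) :
    decoupledNorm μ p f
      ≤ normL1 μ a + normLp μ p b + normL1Lp μ p c + normL1LpSwap μ p d := by
  set a' := fun i j => (h.aesm_a i j).mk (a i j) with ha'
  set b' := fun i j => (h.aesm_b i j).mk (b i j) with hb'
  set c' := fun i j => (h.aesm_c i j).mk (c i j) with hc'
  set d' := fun i j => (h.aesm_d i j).mk (d i j) with hd'
  have ea : ∀ i j, a i j =ᵐ[μ.prod μ] a' i j := fun i j => (h.aesm_a i j).ae_eq_mk
  have eb : ∀ i j, b i j =ᵐ[μ.prod μ] b' i j := fun i j => (h.aesm_b i j).ae_eq_mk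
  have ec : ∀ i j, c i j =ᵐ[μ.prod μ] c' i j := fun i j => (h.aesm_c i j).ae_eq_mk
  have ed : ∀ i j, d i j =ᵐ[μ.prod μ] d' i j := fun i j => (h.aesm_d i j).ae_eq_mk
  have sa : ∀ i j, StronglyMeasurable (a' i j) := fun i j => (h.aesm_a i j).stronglyMeasurable_mk
  have sb : ∀ i j, StronglyMeasurable (b' i j) := fun i j => (h.aesm_b i j).stronglyMeasurable_mk
  have sc : ∀ i j, StronglyMeasurable (c' i j) := fun i j => (h.aesm_c i j).stronglyMeasurable_mk
  have sd : ∀ i j, StronglyMeasurable (d' i j) := fun i j => (h.aesm_d i j).stronglyMeasurable_mk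
  have ma : ∀ i j, Measurable fun z => ‖a' i j z‖ₑ := fun i j => (sa i j).enorm
  have mb : ∀ i j, Measurable fun z => ‖b' i j z‖ₑ := fun i j => (sb i j).enorm
  have mc : ∀ i j, Measurable fun z => ‖c' i j z‖ₑ := fun i j => (sc i j).enorm
  have md : ∀ i j, Measurable fun z => ‖d' i j z‖ₑ := fun i j => (sd i j).enorm
  have ef : ∀ i j, f i j =ᵐ[μ.prod μ] fun z => a' i j z + b' i j z + c' i j z + d' i j z := by
    intro i j
    filter_upwards [h.eq_add i j, ea i j, eb i j, ec i j, ed i j] with z h0 h1 h2 h3 h4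
    rw [h0, h1, h2, h3, h4]
  have ssum : ∀ i j, StronglyMeasurable fun z => a' i j z + b' i j z + c' i j z + d' i j z :=
    fun i j => (((sa i j).add (sb i j)).add (sc i j)).add (sd i j)
  rw [normL1_congr ea, normLp_congr eb, normL1Lp_congr ec, normL1LpSwap_congr ed,
    decoupledNorm_congr ef,
    decoupledNorm_eq_decoupledMean ssum]
  have hmono : decoupledMean μ p (fun i j z => ‖a' i j z + b' i j z + c' i j z + d' i j z‖ₑ)
      ≤ decoupledMean μ p
        (fun i j z => ‖a' i j z‖ₑ + ‖b' i j z‖ₑ + ‖c' i j z‖ₑ + ‖d' i j z‖ₑ) := by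
    refine lintegral_mono fun θ => ?_
    have hp0 : 0 < p := zero_lt_one.trans_le hp
    dsimp only
    gcongr
    refine (enorm_add_le _ _).trans ?_
    gcongr
    refine (enorm_add_le _ _).trans ?_
    gcongr
    exact enorm_add_le _ _
  refine hmono.trans ((decoupledMean_add_le hp (by fun_prop)).trans (add_le_add
    ((decoupledMean_add_le hp (by fun_prop)).trans (add_le_add
      ((decoupledMean_add_le hp ma).trans (add_le_add (decoupledMean_le_L1 hp ma)
        (decoupledMean_le_Lp hp mb))) (decoupledMean_le_L1Lp hp mc))) ?_))
  rw [← decoupledMean_swapFamily p md]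
  exact decoupledMean_le_L1Lp hp (measurable_swapFamily md)

theorem exists_isDecomposition_of_decoupledNorm_le_one (hp : 1 ≤ p)
    {f : Fin n → Fin n → Ω × Ω → 𝕜} (hf : ∀ i j, AEStronglyMeasurable (f i j) (μ.prod μ))
    (hN : decoupledNorm μ p f ≤ 1) :
    ∃ a b c d : Fin n → Fin n → Ω × Ω → 𝕜, IsDecomposition μ f a b c d ∧
      normL1 μ a ≤ 10 ∧ normLp μ p b ≤ 49152 ∧ normL1Lp μ p c ≤ 768 ∧ normL1LpSwap μ p d ≤ 768 ∧
      ∀ i j, Pairwise fun k l : Fin 4 =>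
        Disjoint (Function.support (![a i j, b i j, c i j, d i j] k))
          (Function.support (![a i j, b i j, c i j, d i j] l)) := by
  have hp0 : 0 < p := zero_lt_one.trans_le hp
  set f' := fun i j => (hf i j).mk (f i j) with hf'
  have ef : ∀ i j, f i j =ᵐ[μ.prod μ] f' i j := fun i j => (hf i j).ae_eq_mk
  have sf : ∀ i j, StronglyMeasurable (f' i j) := fun i j => (hf i j).stronglyMeasurable_mk
  set g : Fin n → Fin n → Ω × Ω → ℝ≥0∞ := fun i j z => ‖f' i j z‖ₑ with hgdef
  have hg : ∀ i j, Measurable (g i j) := fun i j => (sf i j).enorm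
  rw [decoupledNorm_congr ef, decoupledNorm_eq_decoupledMean sf] at hN
  set F : Fin 4 → Fin n → Fin n → Ω × Ω → 𝕜 := fun k i j =>
    {z | pieceLabel μ p g i j z = k}.indicator (f' i j) with hF
  have hset : ∀ k i j, MeasurableSet {z | pieceLabel μ p g i j z = k} := fun k i j =>
    measurable_pieceLabel hg i j (measurableSet_singleton k)
  have sF : ∀ k i j, AEStronglyMeasurable (F k i j) (μ.prod μ) := fun k i j =>
    ((sf i j).indicator (hset k i j)).aestronglyMeasurable
  have eF : ∀ k i j z, ‖F k i j z‖ₑ = {z | pieceLabel μ p g i j z = k}.indicator (g i j) z :=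
    fun k i j z => enorm_indicator_eq_indicator_enorm _ _
  have mF : ∀ k i j, Measurable ({z | pieceLabel μ p g i j z = k}.indicator (g i j)) :=
    fun k i j => (hg i j).indicator (hset k i j)
  refine ⟨F 0, F 1, F 2, F 3, ⟨sF 0, sF 1, sF 2, sF 3, fun i j => ?_⟩, ?_, ?_, ?_, ?_, fun i j => ?_⟩
  · filter_upwards [ef i j] with z hz
    rw [hz]
    have hk : ∀ m : Fin 4, m = 0 ∨ m = 1 ∨ m = 2 ∨ m = 3 := by decide
    rcases hk (pieceLabel μ p g i j z) with e | e | e | e <;> simp [hF, e]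
  · refine le_trans (le_of_eq ?_) (sum_sum_lintegral_pieceLabel_zero_le hp hg hN)
    refine Finset.sum_congr rfl fun i _ => Finset.sum_congr rfl fun j _ => ?_
    simp_rw [eF]
    exact (lintegral_prod _ (mF 0 i j).aemeasurable).symm
  · refine le_trans (le_of_eq ?_) (sum_sum_lintegral_pieceLabel_one_le hp hg hN)
    refine congrArg (· ^ (1 / p)) ?_
    refine Finset.sum_congr rfl fun i _ => Finset.sum_congr rfl fun j _ => ?_
    simp_rw [eF]
    exact (lintegral_prod _ ((mF 1 i j).pow_const p).aemeasurable).symm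
  · simpa only [normL1Lp, eF] using sum_lintegral_pieceLabel_two_le hp hg hN
  · simpa only [normL1LpSwap, eF] using sum_lintegral_pieceLabel_three_le hp hg hN
  · have e : ∀ k : Fin 4, ![F 0 i j, F 1 i j, F 2 i j, F 3 i j] k = F k i j := by
      intro k
      fin_cases k <;> rfl
    intro k l hkl
    rw [e, e, Set.disjoint_left]
    intro z hz hz'
    have h1 : z ∈ {z | pieceLabel μ p g i j z = k} := Set.mem_of_indicator_ne_zero hz
    have h2 : z ∈ {z | pieceLabel μ p g i j z = l} := Set.mem_of_indicator_ne_zero hz'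
    exact hkl (Eq.trans (Eq.symm h1) h2)

omit [IsProbabilityMeasure μ] in
theorem fourSumNorm_le_of_isDecomposition {f a b c d : Fin n → Fin n → Ω × Ω → 𝕜}
    (h : IsDecomposition μ f a b c d) :
    fourSumNorm μ p f ≤ normL1 μ a + normLp μ p b + normL1Lp μ p c + normL1LpSwap μ p d :=
  iInf_le_of_le a (iInf_le_of_le b (iInf_le_of_le c (iInf_le_of_le d (iInf_le _ h))))

/-! ### Homogeneity -/

theorem rpow_mul_rpow_one_div (hp : 0 < p) (r s : ℝ≥0∞) :
    (r ^ p * s) ^ (1 / p) = r * s ^ (1 / p) := by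
  rw [ENNReal.mul_rpow_of_nonneg _ _ (by positivity), ← ENNReal.rpow_mul,
    mul_one_div_cancel hp.ne', ENNReal.rpow_one]

omit [IsProbabilityMeasure μ] in
theorem decoupledNorm_const_mul (hp : 0 < p) (r : 𝕜) (f : Fin n → Fin n → Ω × Ω → 𝕜) :
    decoupledNorm μ p (fun i j z => r * f i j z) = ‖r‖ₑ * decoupledNorm μ p f := by
  simp only [decoupledNorm, enorm_mul, ENNReal.mul_rpow_of_nonneg _ _ hp.le, ← Finset.mul_sum,
    rpow_mul_rpow_one_div hp, lintegral_const_mul' _ _ enorm_ne_top]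

omit [IsProbabilityMeasure μ] in
theorem normL1_const_mul (r : 𝕜) (a : Fin n → Fin n → Ω × Ω → 𝕜) :
    normL1 μ (fun i j z => r * a i j z) = ‖r‖ₑ * normL1 μ a := by
  simp only [normL1, enorm_mul, ← Finset.mul_sum, lintegral_const_mul' _ _ enorm_ne_top]

omit [IsProbabilityMeasure μ] in
theorem normLp_const_mul (hp : 0 < p) (r : 𝕜) (b : Fin n → Fin n → Ω × Ω → 𝕜) :
    normLp μ p (fun i j z => r * b i j z) = ‖r‖ₑ * normLp μ p b := by
  have hr : ‖r‖ₑ ^ p ≠ ⊤ := ENNReal.rpow_ne_top_of_nonneg hp.le enorm_ne_top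
  simp only [normLp, enorm_mul, ENNReal.mul_rpow_of_nonneg _ _ hp.le, ← Finset.mul_sum,
    rpow_mul_rpow_one_div hp, lintegral_const_mul' _ _ hr]

omit [IsProbabilityMeasure μ] in
theorem normL1Lp_const_mul (hp : 0 < p) (r : 𝕜) (c : Fin n → Fin n → Ω × Ω → 𝕜) :
    normL1Lp μ p (fun i j z => r * c i j z) = ‖r‖ₑ * normL1Lp μ p c := by
  have hr : ‖r‖ₑ ^ p ≠ ⊤ := ENNReal.rpow_ne_top_of_nonneg hp.le enorm_ne_top
  simp only [normL1Lp, enorm_mul, ENNReal.mul_rpow_of_nonneg _ _ hp.le, ← Finset.mul_sum,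
    rpow_mul_rpow_one_div hp, lintegral_const_mul' _ _ hr, lintegral_const_mul' _ _ enorm_ne_top]

omit [IsProbabilityMeasure μ] in
theorem normL1LpSwap_const_mul (hp : 0 < p) (r : 𝕜) (d : Fin n → Fin n → Ω × Ω → 𝕜) :
    normL1LpSwap μ p (fun i j z => r * d i j z) = ‖r‖ₑ * normL1LpSwap μ p d := by
  have hr : ‖r‖ₑ ^ p ≠ ⊤ := ENNReal.rpow_ne_top_of_nonneg hp.le enorm_ne_top
  simp only [normL1LpSwap, enorm_mul, ENNReal.mul_rpow_of_nonneg _ _ hp.le, ← Finset.mul_sum,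
    rpow_mul_rpow_one_div hp, lintegral_const_mul' _ _ hr, lintegral_const_mul' _ _ enorm_ne_top]

/-- By homogeneity it is enough to decompose families of norm at most one. -/
theorem fourSumNorm_le_mul_decoupledNorm (hp : 1 ≤ p) {f : Fin n → Fin n → Ω × Ω → 𝕜}
    (hf : ∀ i j, AEStronglyMeasurable (f i j) (μ.prod μ)) :
    fourSumNorm μ p f ≤ 50698 * decoupledNorm μ p f := by
  have hp0 : 0 < p := zero_lt_one.trans_le hp
  rw [mul_comm, ← ENNReal.div_le_iff (by simp) (by simp)]
  -- Letting `t` decrease to the norm covers the case of norm zero.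
  refine le_of_forall_gt_imp_ge_of_dense fun t ht => ?_
  rcases eq_or_ne t ⊤ with rfl | htT
  · exact le_top
  have ht0 : t ≠ 0 := (zero_le.trans_lt ht).ne'
  lift t to ℝ≥0 using htT
  have ht0' : t ≠ 0 := by simpa using ht0
  have htk : ((t : ℝ) : 𝕜) ≠ 0 := by simpa using ht0'
  have hen : ‖((t : ℝ) : 𝕜)‖ₑ = t := by
    rw [← ofReal_norm, RCLike.norm_ofReal, abs_of_nonneg t.coe_nonneg, ENNReal.ofReal_coe_nnreal]
  have hN : decoupledNorm μ p (fun i j z => ((t : ℝ) : 𝕜)⁻¹ * f i j z) ≤ 1 := by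
    rw [decoupledNorm_const_mul hp0, enorm_inv htk, hen, mul_comm, ← div_eq_mul_inv]
    exact ENNReal.div_le_of_le_mul (by rw [one_mul]; exact ht.le)
  obtain ⟨a, b, c, d, h, ha, hb, hc, hd, -⟩ := exists_isDecomposition_of_decoupledNorm_le_one hp
    (fun i j => (hf i j).const_mul (((t : ℝ) : 𝕜)⁻¹)) hN
  have hdec : IsDecomposition μ f (fun i j z => ((t : ℝ) : 𝕜) * a i j z)
      (fun i j z => ((t : ℝ) : 𝕜) * b i j z) (fun i j z => ((t : ℝ) : 𝕜) * c i j z)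
      (fun i j z => ((t : ℝ) : 𝕜) * d i j z) := by
    refine ⟨fun i j => (h.aesm_a i j).const_mul _, fun i j => (h.aesm_b i j).const_mul _,
      fun i j => (h.aesm_c i j).const_mul _, fun i j => (h.aesm_d i j).const_mul _, fun i j => ?_⟩
    filter_upwards [h.eq_add i j] with z hz
    rw [← mul_add, ← mul_add, ← mul_add, ← hz, mul_inv_cancel_left₀ htk]
  rw [ENNReal.div_le_iff (by simp) (by simp)]
  refine (fourSumNorm_le_of_isDecomposition hdec).trans ?_
  rw [normL1_const_mul, normLp_const_mul hp0, normL1Lp_const_mul hp0, normL1LpSwap_const_mul hp0,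
    hen, ← mul_add, ← mul_add, ← mul_add]
  gcongr
  calc _ ≤ (10 + 49152 + 768 + 768 : ℝ≥0∞) := by gcongr
    _ = 50698 := by norm_num

end Families

theorem theorem4p3 :
    ∃ C : ℝ≥0, ∀ (𝕜 : Type*) [RCLike 𝕜] (Ω : Type*) [MeasurableSpace Ω] (μ : Measure Ω)
      [IsProbabilityMeasure μ] (n : ℕ) (p : ℝ), 1 ≤ p →
      ∀ f : Fin n → Fin n → Ω × Ω → 𝕜, (∀ i j, Integrable (f i j) (μ.prod μ)) →
        decoupledNorm μ p f ≤ C * fourSumNorm μ p f ∧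
        fourSumNorm μ p f ≤ C * decoupledNorm μ p f ∧
        (decoupledNorm μ p f ≤ 1 →
          ∃ a b c d : Fin n → Fin n → Ω × Ω → 𝕜, IsDecomposition μ f a b c d ∧
            normL1 μ a ≤ C ∧ normLp μ p b ≤ C ∧ normL1Lp μ p c ≤ C ∧ normL1LpSwap μ p d ≤ C ∧
            ∀ i j, Pairwise fun k l : Fin 4 =>
              Disjoint (Function.support (![a i j, b i j, c i j, d i j] k))
                (Function.support (![a i j, b i j, c i j, d i j] l))) := by
  refine ⟨50698, fun 𝕜 _ Ω _ μ _ n p hp f hf => ⟨?_, ?_, fun hN => ?_⟩⟩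
  · refine le_trans (b := fourSumNorm μ p f) ?_ (le_mul_of_one_le_left' (by norm_num))
    exact le_iInf fun a => le_iInf fun b => le_iInf fun c => le_iInf fun d => le_iInf fun h =>
      decoupledNorm_le_of_isDecomposition hp h
  · exact fourSumNorm_le_mul_decoupledNorm hp fun i j => (hf i j).aestronglyMeasurable
  · obtain ⟨a, b, c, d, h, ha, hb, hc, hd, hs⟩ :=
      exists_isDecomposition_of_decoupledNorm_le_one hp
        (fun i j => (hf i j).aestronglyMeasurable) hN
    exact ⟨a, b, c, d, h, ha.trans (by norm_num), hb.trans (by norm_num), hc.trans (by norm_num),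
      hd.trans (by norm_num), hs⟩
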